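/- Let $\delta, K, T>0$, let $V\in C^3(\mathbb R)$ have bounded derivatives $V',V'',V'''$, and let $\varphi_-\in L^2(0,1)$. Write $\|\cdot\|$ for the norm of $L^2(0,1)$. Let $S(t)$, $t\ge 0$, be the contraction semigroup on $L^2(0,1)$ generated by $\delta\,d^2/dx^2$ with domain $H^2(0,1)\cap H^1_0(0,1)$. For $\varphi_0\in L^2(0,1)$, $t_0\in[0,T]$ and a control $\alpha\in L^2(t_0,T;L^2(0,1))$ let $\varphi\in C([t_0,T];L^2(0,1))$ be the mild solution of $\varphi_t=\delta\varphi_{xx}-\delta^{-1}V'(\varphi)+\alpha$, $\varphi(t_0)=\varphi_0$, that is, $$\varphi(t)=S(t-t_0)\varphi_0+\int_{t_0}^{t}S(t-s)\big(-\delta^{-1}V'(\varphi(s))+\alpha(s)\big)\,ds,\qquad t_0\le t\le T,$$ and define the value function $$u(\varphi_0,t_0)=\inf_{\alpha\in L^2(t_0,T;L^2(0,1))}\Big\{\int_{t_0}^T\tfrac12\|\alpha(t)\|^2\,dt+K\|\varphi(T)-\varphi_-\|^2\Big\}.$$ Then the restriction of $u$ to $H^1_0(0,1)\times[0,T)$ is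 semiconcave (with linear modulus) in the following sense. For every constant $B$ and every closed interval $I\subset[0,T)$ there is a constant $C$ such that for all $\varphi_0^1,\varphi_0^2\in H^1_0(0,1)$ with $\|\varphi^1_0\|_{H^1_0}+\|\varphi^2_0\|_{H^1_0}\le B$ and all $t^1,t^2\in I$ $$u(\varphi_0^1,t^1)+u(\varphi_0^2,t^2)-2u\Big(\frac{\varphi^1_0+\varphi^2_0}{2},\frac{t^1+t^2}{2}\Big)\le C\big(\|\varphi_0^1-\varphi_0^2\|^2_{H^1_0}+|t^1-t^2|^2\big),$$ and, more generally, for all $r\in[0,1]$, $$r\,u(\varphi_0^1,t^1)+(1-r)\,u(\varphi_0^2,t^2)-u\big(r\varphi^1_0+(1-r)\varphi^2_0,\;rt^1+(1-r)t^2\big)\le C\,r(1-r)\big(\|\varphi_0^1-\varphi_0^2\|^2_{H^1_0}+|t^1-t^2|^2\big).$$ -/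

import Mathlib

open MeasureTheory Set
open scoped ContDiff

noncomputable section

namespace SemiconcaveValue

/-- The real Hilbert space `L²(0,1)`. -/
abbrev L2 : Type := Lp ℝ 2 (volume.restrict (Ioo (0 : ℝ) 1))

/-! ### The Sobolev space `H¹₀(0,1)` -/

/-- The pairs `(η, η')` of classes in `L²(0,1) × L²(0,1)`, where `η` is a smooth function with
compact support contained in `(0,1)`. -/
def testPairs : Submodule ℝ (WithLp 2 (L2 × L2)) where
  carrier := {p | ∃ η : ℝ → ℝ, ContDiff ℝ ∞ η ∧ HasCompactSupport η ∧ tsupport η ⊆ Ioo 0 1 ∧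
    p.fst =ᵐ[volume.restrict (Ioo (0 : ℝ) 1)] η ∧
    p.snd =ᵐ[volume.restrict (Ioo (0 : ℝ) 1)] deriv η}
  zero_mem' := by
    refine ⟨fun _ => (0 : ℝ), (contDiff_const : ContDiff ℝ ∞ fun _ : ℝ => (0 : ℝ)), HasCompactSupport.zero, ?_, ?_, ?_⟩
    · rw [show (fun _ : ℝ => (0 : ℝ)) = 0 from rfl, tsupport_zero]
      exact empty_subset _
    · exact Lp.coeFn_zero ℝ 2 (volume.restrict (Ioo (0 : ℝ) 1))
    · rw [deriv_const']
      exact Lp.coeFn_zero ℝ 2 (volume.restrict (Ioo (0 : ℝ) 1))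
  add_mem' := by
    rintro p q ⟨η, h1, h2, h3, h4, h5⟩ ⟨ζ, k1, k2, k3, k4, k5⟩
    refine ⟨η + ζ, h1.add k1, h2.add k2,
      (tsupport_add η ζ).trans (union_subset h3 k3), ?_, ?_⟩
    · exact (Lp.coeFn_add _ _).trans (h4.add k4)
    · have hd : deriv (η + ζ) = deriv η + deriv ζ := by
        ext x
        exact deriv_add (h1.differentiable (by simp) x) (k1.differentiable (by simp) x)
      rw [hd]
      exact (Lp.coeFn_add _ _).trans (h5.add k5)
  smul_mem' := by
    rintro c p ⟨η, h1, h2, h3, h4, h5⟩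
    refine ⟨c • η, contDiff_const.smul h1, h2.smul_left (f := fun _ => c),
      (tsupport_smul_subset_right (fun _ => c) η).trans h3, ?_, ?_⟩
    · exact (Lp.coeFn_smul _ _).trans (h4.const_smul c)
    · have hd : deriv (c • η) = c • deriv η := by
        ext x
        exact deriv_const_smul c (h1.differentiable (by simp) x)
      rw [hd]
      exact (Lp.coeFn_smul _ _).trans (h5.const_smul c)

/-- The Sobolev space `H¹₀(0,1)`: the completion of `C_c^∞(0,1)` for the norm
`(‖φ‖² + ‖φₓ‖²)^{1/2}`, realized as the closure of the pairs `(η, η')` in `L² × L²`. An element is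
a pair `(φ, φₓ)` consisting of a function and its weak derivative, and the norm inherited from
the Hilbert space `L² × L²` is the `H¹` norm. -/
abbrev H10 : Submodule ℝ (WithLp 2 (L2 × L2)) := testPairs.topologicalClosure

/-- The inclusion of `H¹₀(0,1)` in `L²(0,1)`. -/
def toL2 (φ : H10) : L2 := (φ : WithLp 2 (L2 × L2)).fst

/-! ### The Dirichlet heat semigroup -/

theorem memLp_sine (k : ℕ) :
    MemLp (fun x : ℝ => √2 * Real.sin ((k + 1) * Real.pi * x)) 2
      (volume.restrict (Ioo (0 : ℝ) 1)) := by
  refine MemLp.of_bound (C := √2) (by fun_prop) (Filter.Eventually.of_forall fun x => ?_)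
  rw [norm_mul, Real.norm_of_nonneg (Real.sqrt_nonneg 2)]
  exact mul_le_of_le_one_right (Real.sqrt_nonneg 2) (Real.abs_sin_le_one _)

/-- The eigenfunctions `x ↦ √2 sin((k+1)πx)`, `k = 0, 1, 2, …`, of `d²/dx²` on
`H²(0,1) ∩ H¹₀(0,1)`, with the eigenvalues `-((k+1)π)²`; they are an orthonormal basis of
`L²(0,1)`. -/
def sineMode (k : ℕ) : L2 := (memLp_sine k).toLp _

/-- The contraction semigroup `S(t)`, `t ≥ 0`, on `L²(0,1)` generated by `δ d²/dx²` with domain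
`H²(0,1) ∩ H¹₀(0,1)`, written in the basis of eigenfunctions of its generator. -/
def heatSemigroup (δ t : ℝ) (φ : L2) : L2 :=
  ∑' k : ℕ, (Real.exp (-(δ * ((k + 1) * Real.pi) ^ 2 * t)) * inner ℝ (sineMode k) φ) • sineMode k

/-! ### The controlled equation and the value function -/

open Classical in
/-- The superposition operator `φ ↦ f ∘ φ` on `L²(0,1)`. For a bounded continuous `f`, the only case
in which it is used, `f ∘ φ` is in `L²(0,1)` for every `φ`. -/
def superposition (f : ℝ → ℝ) (φ : L2) : L2 :=
  if h : MemLp (fun x => f (φ x)) 2 (volume.restrict (Ioo (0 : ℝ) 1)) then h.toLp _ else 0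

/-- `φ ∈ C([t₀,T]; L²(0,1))` is a mild solution of
`φ_t = δ φ_xx - δ⁻¹ V'(φ) + α`, `φ(t₀) = φ₀`, on `[t₀,T]`, with Dirichlet boundary conditions. -/
def IsMildSolution (δ T : ℝ) (V : ℝ → ℝ) (φ₀ : L2) (t₀ : ℝ) (α φ : ℝ → L2) : Prop :=
  ContinuousOn φ (Icc t₀ T) ∧
    ∀ t ∈ Icc t₀ T, φ t = heatSemigroup δ (t - t₀) φ₀ +
      ∫ s in t₀..t,
        heatSemigroup δ (t - s) (-(δ⁻¹ • superposition (deriv V) (φ s)) + α s)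

/-- The cost `∫_{t₀}^T h(α(t)) dt + g(φ(T))` of a control `α` with state `φ`, where
`h(α) = ‖α‖²/2` and `g(φ) = K ‖φ - φ₋‖²`. -/
def cost (K T : ℝ) (φm : L2) (t₀ : ℝ) (α φ : ℝ → L2) : ℝ :=
  (∫ t in t₀..T, ‖α t‖ ^ 2 / 2) + K * ‖φ T - φm‖ ^ 2

/-- The value function: the infimum of the cost over all controls `α ∈ L²(t₀,T; L²(0,1))`, with `φ`
the mild solution with control `α` that starts in `φ₀` at the time `t₀`. -/
def valueFunction (δ K T : ℝ) (V : ℝ → ℝ) (φm : L2) (φ₀ : L2) (t₀ : ℝ) : ℝ :=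
  sInf {c : ℝ | ∃ α φ : ℝ → L2, MemLp α 2 (volume.restrict (Ioo t₀ T)) ∧
    IsMildSolution δ T V φ₀ t₀ α φ ∧ c = cost K T φm t₀ α φ}

end SemiconcaveValue

end

/-!
The comparison is made on the unit time interval. With `L = T - t₀`, a control problem with initial
time `t₀` is rewritten for `z(σ) = φ(t₀ + Lσ)` and the drive `a(σ) = L α(t₀ + Lσ)`:
`z(σ) = S(Lσ) φ₀ + ∫₀^σ S(L(σ - s)) (L F(z(s)) + a(s)) ds`, where `F(φ) = -δ⁻¹ V'(φ)`. A nearly optimal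
control for the intermediate point `(φ_r, t_r)` yields, with the *same* drive `a`, admissible controls
for the two end points (`exists_rescale_eq`), so that the second difference of the value function is
at most that of the cost along the three solutions `z`, `z₁`, `z₂`.

The unbounded operator does no harm to this change of time, because the semigroup is analytic: in
each mode, `L ↦ e^{-νLτ}` has first and second derivatives bounded uniformly in `ντ ≥ 0` as long as
`L` is bounded below, which is where initial times have to stay away from `T`
(`norm_second_difference_heatSemigroup_le`). The difficulty is the nonlinearity, whose second
differences in `L²` are controlled by `|z₁ - z₂|²`, a square that has to be estimated in `L²`. The
smoothing `L² → L^∞` of the semigroup, with the norm `O(τ^{-3/8})`, gives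
`‖z₁(σ) - z₂(σ)‖_∞ ≤ C (σ^{-3/8} + 1) (‖φ₁ - φ₂‖ + |t₁ - t₂|)` (`exists_supLE_scaledSolution_sub`), and
`σ^{-3/4}` is integrable. Grönwall's inequality then bounds `r z₁ + (1 - r) z₂ - z` by
`C r (1 - r) (‖φ₁ - φ₂‖ + |t₁ - t₂|)²` (`exists_norm_scaledSolution_second_difference_le`).

The terminal cost is a squared norm and the control cost is `∫ ‖a‖² / (2L)`, so both have second
differences of the required order (`exists_valueFunction_second_difference_le`). The argument yields
the estimate with `L²` norms of the initial values, which are at most their `H¹₀` norms. The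
completeness of the sine modes is never needed: the semigroup vanishes on the orthogonal complement
of their span.
-/

namespace SemiconcaveValue

/-! ### Diagonal operators on an orthonormal sequence -/

section Diagonal

variable {H : Type*} [NormedAddCommGroup H] [InnerProductSpace ℝ H] {e : ℕ → H}

/-- The diagonal operator `f ↦ ∑ₖ mₖ ⟨eₖ, f⟩ eₖ` with multiplier `m`. The sequence `e` need not be
complete, so that the multiplier `1` gives an orthogonal projection. -/
noncomputable def diag (e : ℕ → H) (m : ℕ → ℝ) (f : H) : H :=
  ∑' k, (m k * inner ℝ (e k) f) • e k

variable {m m' : ℕ → ℝ} {c : ℝ}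

theorem diag_smul (e : ℕ → H) (m : ℕ → ℝ) (a : ℝ) (f : H) : diag e m (a • f) = a • diag e m f := by
  rw [diag, diag, ← tsum_const_smul'']
  refine tsum_congr fun k => ?_
  rw [inner_smul_right]; module

theorem summable_mul_inner_sq (he : Orthonormal ℝ e) (hm : ∀ k, |m k| ≤ c) (f : H) :
    Summable fun k => (m k * inner ℝ (e k) f) ^ 2 := by
  refine Summable.of_nonneg_of_le (fun k => sq_nonneg _) (fun k => ?_)
    ((he.inner_products_summable f).mul_left (c ^ 2))
  rw [mul_pow, Real.norm_eq_abs, sq_abs]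
  exact mul_le_mul_of_nonneg_right
    (sq_le_sq' (neg_le_of_abs_le (hm k)) (le_of_abs_le (hm k))) (sq_nonneg _)

variable [CompleteSpace H]

theorem hasSum_diag (he : Orthonormal ℝ e) (hm : ∀ k, |m k| ≤ c) (f : H) :
    HasSum (fun k => (m k * inner ℝ (e k) f) • e k) (diag e m f) := by
  have h := (he.orthogonalFamily.summable_iff_norm_sq_summable
    (fun k => m k * inner ℝ (e k) f)).2 (by
      simpa only [Real.norm_eq_abs, sq_abs] using summable_mul_inner_sq he hm f)
  simp only [LinearIsometry.toSpanSingleton_apply] at h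
  exact h.hasSum

theorem inner_diag (he : Orthonormal ℝ e) (hm : ∀ k, |m k| ≤ c) (f : H) (j : ℕ) :
    inner ℝ (e j) (diag e m f) = m j * inner ℝ (e j) f := by
  have h := (hasSum_diag he hm f).mapL (innerSL ℝ (e j))
  refine h.unique ?_
  convert hasSum_single j ?_ using 1
  · simp [he.1 j]
  · intro k hk
    simp [he.2 (Ne.symm hk)]

theorem norm_diag_sq (he : Orthonormal ℝ e) (hm : ∀ k, |m k| ≤ c) (f : H) :
    ‖diag e m f‖ ^ 2 = ∑' k, (m k * inner ℝ (e k) f) ^ 2 := by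
  have h := (hasSum_diag he hm f).mapL (innerSL ℝ (diag e m f))
  simp only [innerSL_apply_apply, inner_smul_right] at h
  rw [real_inner_self_eq_norm_sq] at h
  rw [← h.tsum_eq]
  refine tsum_congr fun k => ?_
  rw [real_inner_comm (e k) (diag e m f), inner_diag he hm, sq]

theorem norm_diag_le (he : Orthonormal ℝ e) (hc : 0 ≤ c) (hm : ∀ k, |m k| ≤ c) (f : H) :
    ‖diag e m f‖ ≤ c * ‖f‖ := by
  refine le_of_sq_le_sq ?_ (by positivity)
  rw [norm_diag_sq he hm, mul_pow]
  refine le_trans ?_ (mul_le_mul_of_nonneg_left (he.tsum_inner_products_le f) (sq_nonneg c))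
  rw [← tsum_mul_left]
  refine Summable.tsum_le_tsum (fun k => ?_) (summable_mul_inner_sq he hm f)
    ((he.inner_products_summable f).mul_left _)
  rw [mul_pow, Real.norm_eq_abs, sq_abs]
  exact mul_le_mul_of_nonneg_right
    (sq_le_sq' (neg_le_of_abs_le (hm k)) (le_of_abs_le (hm k))) (sq_nonneg _)

theorem diag_add (he : Orthonormal ℝ e) (hm : ∀ k, |m k| ≤ c) (f g : H) :
    diag e m (f + g) = diag e m f + diag e m g := by
  refine (HasSum.unique ?_ (hasSum_diag he hm (f + g))).symm
  convert (hasSum_diag he hm f).add (hasSum_diag he hm g) using 2 with k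
  rw [inner_add_right]; module

theorem diag_sub (he : Orthonormal ℝ e) (hm : ∀ k, |m k| ≤ c) (f g : H) :
    diag e m (f - g) = diag e m f - diag e m g := by
  have h := diag_smul e m (-1) g
  rw [neg_one_smul, neg_one_smul] at h
  rw [sub_eq_add_neg, diag_add he hm, h, sub_eq_add_neg]

theorem diag_sub_multiplier (he : Orthonormal ℝ e) (hm : ∀ k, |m k| ≤ c) (hm' : ∀ k, |m' k| ≤ c)
    (f : H) : diag e m f - diag e m' f = diag e (fun k => m k - m' k) f := by
  have h : ∀ k, |m k - m' k| ≤ c + c := fun k =>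
    (abs_sub _ _).trans (add_le_add (hm k) (hm' k))
  refine HasSum.unique ?_ (hasSum_diag he h f)
  convert (hasSum_diag he hm f).sub (hasSum_diag he hm' f) using 2 with k
  module

/-- Pointwise convergence of uniformly bounded multipliers gives strong convergence of the diagonal
operators. -/
theorem tendsto_diag {α : Type*} {l : Filter α} (he : Orthonormal ℝ e) {m : α → ℕ → ℝ}
    {m₀ : ℕ → ℝ} (hm : ∀ᶠ x in l, ∀ k, |m x k| ≤ c) (hm₀ : ∀ k, |m₀ k| ≤ c)
    (h : ∀ k, Filter.Tendsto (fun x => m x k) l (nhds (m₀ k))) (f : H) :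
    Filter.Tendsto (fun x => diag e (m x) f) l (nhds (diag e m₀ f)) := by
  rw [tendsto_iff_norm_sub_tendsto_zero]
  have h2 : Filter.Tendsto (fun x => ‖diag e (m x) f - diag e m₀ f‖ ^ 2) l (nhds 0) := by
    have h3 : Filter.Tendsto (fun x => ∑' k, ((m x k - m₀ k) * inner ℝ (e k) f) ^ 2) l
        (nhds (∑' _ : ℕ, (0 : ℝ))) := by
      refine tendsto_tsum_of_dominated_convergence
        (bound := fun k => (c + c) ^ 2 * ‖inner ℝ (e k) f‖ ^ 2)
        ((he.inner_products_summable f).mul_left _) (fun k => ?_) ?_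
      · have := (((h k).sub_const (m₀ k)).mul_const (inner ℝ (e k) f)).pow 2
        simpa using this
      · filter_upwards [hm] with x hx k
        rw [Real.norm_eq_abs, Real.norm_eq_abs, abs_pow, abs_mul, mul_pow]
        refine mul_le_mul_of_nonneg_right ?_ (sq_nonneg _)
        exact pow_le_pow_left₀ (abs_nonneg _)
          ((abs_sub _ _).trans (add_le_add (hx k) (hm₀ k))) 2
    rw [tsum_zero] at h3
    refine h3.congr' ?_
    filter_upwards [hm] with x hx
    rw [diag_sub_multiplier he hx hm₀, norm_diag_sq he (c := c + c)]
    exact fun k => (abs_sub _ _).trans (add_le_add (hx k) (hm₀ k))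
  have h4 := h2.sqrt
  simpa using h4

/-- Measurability follows from that of the partial sums, so that no joint continuity of the semigroup
in time and state is needed. -/
theorem integrable_diag {X : Type*} [MeasurableSpace X] {μ : Measure X} (he : Orthonormal ℝ e)
    (hc : 0 ≤ c) {m : X → ℕ → ℝ} {f : X → H} (hm : ∀ k, Measurable fun x => m x k)
    (hb : ∀ᵐ x ∂μ, ∀ k, |m x k| ≤ c) (hf : Integrable f μ) :
    Integrable (fun x => diag e (m x) (f x)) μ := by
  have hmeas : AEStronglyMeasurable (fun x => diag e (m x) (f x)) μ := by
    refine aestronglyMeasurable_of_tendsto_ae Filter.atTop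
      (f := fun n x => ∑ k ∈ Finset.range n, (m x k * inner ℝ (e k) (f x)) • e k) (fun n => ?_) ?_
    · refine Finset.aestronglyMeasurable_fun_sum _ fun k _ => ?_
      exact ((hm k).aestronglyMeasurable.mul (hf.1.const_inner)).smul_const _
    · filter_upwards [hb] with x hx
      exact (hasSum_diag he hx (f x)).tendsto_sum_nat
  refine (hf.norm.const_mul c).mono' hmeas ?_
  filter_upwards [hb] with x hx
  exact norm_diag_le he hc hx (f x)

end Diagonal

/-! ### Second differences -/

theorem exists_sub_eq_mul_sub {g g' : ℝ → ℝ} {s : Set ℝ} (hs : s.OrdConnected)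
    (hg : ∀ x ∈ s, HasDerivAt g (g' x) x) {p q : ℝ} (hp : p ∈ s) (hq : q ∈ s) :
    ∃ ξ ∈ uIcc p q, g p - g q = g' ξ * (p - q) := by
  rcases lt_trichotomy p q with h | h | h
  · have hsub : Icc p q ⊆ s := hs.out hp hq
    obtain ⟨ξ, hξ, h1⟩ := exists_hasDerivAt_eq_slope g g' h
      (fun x hx => (hg x (hsub hx)).continuousAt.continuousWithinAt)
      (fun x hx => hg x (hsub (Ioo_subset_Icc_self hx)))
    refine ⟨ξ, Icc_subset_uIcc (Ioo_subset_Icc_self hξ), ?_⟩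
    rw [h1]
    have : q - p ≠ 0 := (sub_pos.2 h).ne'
    field_simp
    ring
  · exact ⟨p, left_mem_uIcc, by simp [h]⟩
  · have hsub : Icc q p ⊆ s := hs.out hq hp
    obtain ⟨ξ, hξ, h1⟩ := exists_hasDerivAt_eq_slope g g' h
      (fun x hx => (hg x (hsub hx)).continuousAt.continuousWithinAt)
      (fun x hx => hg x (hsub (Ioo_subset_Icc_self hx)))
    refine ⟨ξ, Icc_subset_uIcc' (Ioo_subset_Icc_self hξ), ?_⟩
    rw [h1]
    have : p - q ≠ 0 := (sub_pos.2 h).ne'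
    field_simp

/-- A function with Lipschitz derivative is both semiconvex and semiconcave. -/
theorem abs_second_difference_le {g g' : ℝ → ℝ} {s : Set ℝ} (hs : s.OrdConnected) {M : ℝ}
    (hM : 0 ≤ M) (hg : ∀ x ∈ s, HasDerivAt g (g' x) x)
    (hL : ∀ x ∈ s, ∀ y ∈ s, |g' x - g' y| ≤ M * |x - y|) {a b r : ℝ} (ha : a ∈ s) (hb : b ∈ s)
    (hr : r ∈ Icc (0 : ℝ) 1) :
    |r * g a + (1 - r) * g b - g (r * a + (1 - r) * b)| ≤ M * (r * (1 - r)) * (a - b) ^ 2 := by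
  obtain ⟨hr0, hr1⟩ := hr
  have hsub := hs.uIcc_subset ha hb
  have hcm : r * a + (1 - r) * b ∈ uIcc a b := by
    rw [← segment_eq_uIcc]
    exact ⟨r, 1 - r, hr0, by linarith, by ring, by simp⟩
  have hc := hsub hcm
  obtain ⟨ξ, hξ, h1⟩ := exists_sub_eq_mul_sub hs hg ha hc
  obtain ⟨η, hη, h2⟩ := exists_sub_eq_mul_sub hs hg hb hc
  have hξ' : ξ ∈ uIcc a b := uIcc_subset_uIcc left_mem_uIcc hcm hξ
  have hη' : η ∈ uIcc a b := uIcc_subset_uIcc right_mem_uIcc hcm hη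
  have h3 : |g' ξ - g' η| ≤ M * |a - b| :=
    (hL _ (hsub hξ') _ (hsub hη')).trans
      (mul_le_mul_of_nonneg_left (Real.dist_le_of_mem_uIcc hξ' hη') hM)
  have h4 : r * g a + (1 - r) * g b - g (r * a + (1 - r) * b)
      = (r * (1 - r)) * ((g' ξ - g' η) * (a - b)) := by
    linear_combination r * h1 + (1 - r) * h2
  have h5 : 0 ≤ r * (1 - r) := mul_nonneg hr0 (by linarith)
  rw [h4, abs_mul, abs_mul (g' ξ - g' η), abs_of_nonneg h5, ← sq_abs (a - b)]
  nlinarith [mul_le_mul_of_nonneg_left (mul_le_mul_of_nonneg_right h3 (abs_nonneg (a - b))) h5]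

theorem mul_exp_neg_le {x l : ℝ} (hl : 0 < l) : x * Real.exp (-(x * l / 2)) ≤ 2 / l := by
  have h1 : x * l / 2 ≤ Real.exp (x * l / 2) := by linarith [Real.add_one_le_exp (x * l / 2)]
  rw [Real.exp_neg, ← div_eq_mul_inv, div_le_div_iff₀ (Real.exp_pos _) hl]
  linarith

/-- The dependence of `e^{-xL}` on `L ≥ l` is Lipschitz uniformly in `x ≥ 0`, with half of the decay
in `x` to spare. -/
theorem abs_exp_neg_sub_exp_neg_le {x l L₁ L₂ : ℝ} (hx : 0 ≤ x) (hl : 0 < l) (h₁ : l ≤ L₁)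
    (h₂ : l ≤ L₂) :
    |Real.exp (-(x * L₁)) - Real.exp (-(x * L₂))|
      ≤ 2 / l * |L₁ - L₂| * Real.exp (-(x * l / 2)) := by
  wlog h : L₁ ≤ L₂ generalizing L₁ L₂
  · rw [abs_sub_comm, abs_sub_comm L₁]
    exact this h₂ h₁ (le_of_not_ge h)
  have e1 : Real.exp (-(x * L₂)) = Real.exp (-(x * L₁)) * Real.exp (-(x * (L₂ - L₁))) := by
    rw [← Real.exp_add]; ring_nf
  have e2 : 0 ≤ 1 - Real.exp (-(x * (L₂ - L₁))) := by
    have : Real.exp (-(x * (L₂ - L₁))) ≤ 1 :=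
      Real.exp_le_one_iff.2 (neg_nonpos.2 (mul_nonneg hx (by linarith)))
    linarith
  have e3 : 1 - Real.exp (-(x * (L₂ - L₁))) ≤ x * (L₂ - L₁) := by
    linarith [Real.add_one_le_exp (-(x * (L₂ - L₁)))]
  have e4 : Real.exp (-(x * L₁)) ≤ Real.exp (-(x * l / 2)) * Real.exp (-(x * l / 2)) := by
    rw [← Real.exp_add]
    exact Real.exp_le_exp.2 (by nlinarith)
  rw [e1, show Real.exp (-(x * L₁)) - Real.exp (-(x * L₁)) * Real.exp (-(x * (L₂ - L₁)))
    = Real.exp (-(x * L₁)) * (1 - Real.exp (-(x * (L₂ - L₁)))) by ring, abs_mul, Real.abs_exp,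
    abs_of_nonneg e2, abs_sub_comm, abs_of_nonneg (sub_nonneg.2 h)]
  calc _ ≤ Real.exp (-(x * l / 2)) * Real.exp (-(x * l / 2)) * (x * (L₂ - L₁)) :=
        mul_le_mul e4 e3 e2 (by positivity)
    _ = x * Real.exp (-(x * l / 2)) * ((L₂ - L₁) * Real.exp (-(x * l / 2))) := by ring
    _ ≤ 2 / l * ((L₂ - L₁) * Real.exp (-(x * l / 2))) :=
        mul_le_mul_of_nonneg_right (mul_exp_neg_le hl)
          (mul_nonneg (by linarith) (Real.exp_pos _).le)
    _ = _ := by ring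

/-- The decay to spare in `abs_exp_neg_sub_exp_neg_le` absorbs the factor `x` of the derivative, so
that the constant does not depend on `x`. -/
theorem abs_second_difference_exp_le {x l L₁ L₂ r : ℝ} (hx : 0 ≤ x) (hl : 0 < l) (h₁ : l ≤ L₁)
    (h₂ : l ≤ L₂) (hr : r ∈ Icc (0 : ℝ) 1) :
    |r * Real.exp (-(x * L₁)) + (1 - r) * Real.exp (-(x * L₂))
        - Real.exp (-(x * (r * L₁ + (1 - r) * L₂)))|
      ≤ (2 / l) ^ 2 * (r * (1 - r)) * (L₁ - L₂) ^ 2 := by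
  refine abs_second_difference_le (g := fun L => Real.exp (-(x * L)))
    (g' := fun L => -x * Real.exp (-(x * L))) (s := Ici l) ordConnected_Ici (by positivity)
    (fun y _ => ?_) (fun y hy z hz => ?_) h₁ h₂ hr
  · refine ((hasDerivAt_id y).const_mul x).neg.exp.congr_deriv ?_
    change Real.exp (-(x * y)) * -(x * 1) = _
    ring
  · rw [← mul_sub, abs_mul, abs_neg, abs_of_nonneg hx]
    calc _ ≤ x * (2 / l * |y - z| * Real.exp (-(x * l / 2))) :=
          mul_le_mul_of_nonneg_left (abs_exp_neg_sub_exp_neg_le hx hl hy hz) hx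
      _ = x * Real.exp (-(x * l / 2)) * (2 / l * |y - z|) := by ring
      _ ≤ 2 / l * (2 / l * |y - z|) :=
          mul_le_mul_of_nonneg_right (mul_exp_neg_le hl) (by positivity)
      _ = _ := by ring

/-! ### Essential bounds of classes in `L²(0,1)` -/

/-- The measure on `(0,1)`. -/
noncomputable abbrev unitMeasure : Measure ℝ := volume.restrict (Ioo (0 : ℝ) 1)

instance : IsProbabilityMeasure unitMeasure := ⟨by simp⟩

/-- `|h| ≤ c` almost everywhere, expressed by the integrals of `h` over measurable sets. In this form
the bound visibly passes to limits, series and Bochner integrals in `L²(0,1)`. -/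
def SupLE (h : L2) (c : ℝ) : Prop :=
  ∀ A : Set ℝ, MeasurableSet A → |∫ x in A, h x ∂unitMeasure| ≤ c * unitMeasure.real A

/-- The indicator of a measurable set in `L²(0,1)`. The inner product with it is the integral over the
set. -/
noncomputable def indicatorL2 {A : Set ℝ} (hA : MeasurableSet A) : L2 :=
  indicatorConstLp 2 hA (measure_ne_top unitMeasure A) (1 : ℝ)

theorem inner_indicatorL2 {A : Set ℝ} (hA : MeasurableSet A) (h : L2) :
    inner ℝ (indicatorL2 hA) h = ∫ x in A, h x ∂unitMeasure :=
  L2.inner_indicatorConstLp_one hA _ h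

theorem supLE_iff {h : L2} {c : ℝ} :
    SupLE h c ↔ ∀ A : Set ℝ, ∀ hA : MeasurableSet A,
      |inner ℝ (indicatorL2 hA) h| ≤ c * unitMeasure.real A := by
  simp only [inner_indicatorL2, SupLE]

theorem integrable_coe (h : L2) : Integrable h unitMeasure :=
  (Lp.memLp h).integrable (by norm_num)

theorem SupLE.ae_abs_le {h : L2} {c : ℝ} (hh : SupLE h c) : ∀ᵐ x ∂unitMeasure, |h x| ≤ c := by
  have h1 : (h : ℝ → ℝ) ≤ᵐ[unitMeasure] fun _ => c := by
    refine ae_le_of_forall_setIntegral_le (integrable_coe h) (integrable_const c) fun A hA _ => ?_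
    rw [setIntegral_const, smul_eq_mul, mul_comm]
    exact (le_abs_self _).trans (hh A hA)
  have h2 : (fun _ => -c) ≤ᵐ[unitMeasure] (h : ℝ → ℝ) := by
    refine ae_le_of_forall_setIntegral_le (integrable_const _) (integrable_coe h) fun A hA _ => ?_
    rw [setIntegral_const, smul_eq_mul, mul_comm]
    linarith [neg_abs_le (∫ x in A, h x ∂unitMeasure), hh A hA]
  filter_upwards [h1, h2] with x hx1 hx2
  exact abs_le.2 ⟨hx2, hx1⟩

theorem SupLE.mono {h : L2} {c d : ℝ} (hh : SupLE h c) (hcd : c ≤ d) : SupLE h d := fun A hA =>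
  (hh A hA).trans (mul_le_mul_of_nonneg_right hcd measureReal_nonneg)

theorem SupLE.add {h g : L2} {c d : ℝ} (hh : SupLE h c) (hg : SupLE g d) :
    SupLE (h + g) (c + d) := by
  rw [supLE_iff] at *
  intro A hA
  rw [inner_add_right, add_mul]
  exact (abs_add_le _ _).trans (add_le_add (hh A hA) (hg A hA))

theorem SupLE.intervalIntegral {f : ℝ → L2} {κ : ℝ → ℝ} {p q : ℝ} (hpq : p ≤ q)
    (hf : IntervalIntegrable f volume p q) (hκ : IntervalIntegrable κ volume p q)
    (h : ∀ s ∈ Ioo p q, SupLE (f s) (κ s)) : SupLE (∫ s in p..q, f s) (∫ s in p..q, κ s) := by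
  rw [supLE_iff]
  intro A hA
  have h1 := (innerSL ℝ (indicatorL2 hA)).intervalIntegral_comp_comm hf
  simp only [innerSL_apply_apply] at h1
  rw [← h1, ← intervalIntegral.integral_mul_const, ← Real.norm_eq_abs]
  refine intervalIntegral.norm_integral_le_of_norm_le hpq ?_ (hκ.mul_const _)
  have hq : ∀ᵐ s : ℝ, s ≠ q := by simp [ae_iff]
  filter_upwards [hq] with s hs hs'
  exact supLE_iff.1 (h s ⟨hs'.1, lt_of_le_of_ne hs'.2 hs⟩) A hA

/-! ### The sine modes and the smoothing property of the heat semigroup -/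

theorem sineMode_coe (k : ℕ) :
    sineMode k =ᵐ[unitMeasure] fun x : ℝ => √2 * Real.sin ((k + 1) * Real.pi * x) :=
  (memLp_sine k).coeFn_toLp

theorem integral_cos_int_mul_pi {n : ℤ} (hn : n ≠ 0) :
    ∫ x in (0 : ℝ)..1, Real.cos (n * Real.pi * x) = 0 := by
  have hc : (n * Real.pi : ℝ) ≠ 0 := mul_ne_zero (by exact_mod_cast hn) Real.pi_ne_zero
  rw [intervalIntegral.integral_comp_mul_left (fun x => Real.cos x) hc]
  simp [integral_cos, Real.sin_int_mul_pi]

theorem orthonormal_sineMode : Orthonormal ℝ sineMode := by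
  have key : ∀ j k : ℕ, inner ℝ (sineMode j) (sineMode k)
      = ∫ x in (0 : ℝ)..1, (Real.cos (((j : ℤ) - k : ℤ) * Real.pi * x)
          - Real.cos (((j : ℤ) + k + 2 : ℤ) * Real.pi * x)) := by
    intro j k
    rw [L2.inner_def, intervalIntegral.integral_of_le zero_le_one, integral_Ioc_eq_integral_Ioo]
    refine integral_congr_ae ?_
    filter_upwards [sineMode_coe j, sineMode_coe k] with x hj hk
    rw [hj, hk]
    have h2 : √2 * √2 = (2 : ℝ) := Real.mul_self_sqrt (by norm_num)
    have e1 : ((((j : ℤ) - k : ℤ) : ℝ) * Real.pi * x)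
        = (j + 1) * Real.pi * x - (k + 1) * Real.pi * x := by push_cast; ring
    have e2 : ((((j : ℤ) + k + 2 : ℤ) : ℝ) * Real.pi * x)
        = (j + 1) * Real.pi * x + (k + 1) * Real.pi * x := by push_cast; ring
    rw [e1, e2, Real.cos_sub, Real.cos_add]
    rw [real_inner_eq_re_inner, RCLike.inner_apply, conj_trivial, RCLike.re_to_real]
    linear_combination
      (Real.sin ((j + 1) * Real.pi * x) * Real.sin ((k + 1) * Real.pi * x)) * h2
  have hint : ∀ n : ℤ, IntervalIntegrable (fun x => Real.cos (n * Real.pi * x)) volume 0 1 :=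
    fun n => (by fun_prop : Continuous fun x : ℝ => Real.cos (n * Real.pi * x)).intervalIntegrable _ _
  have key2 : ∀ j k : ℕ, inner ℝ (sineMode j) (sineMode k) = if j = k then (1 : ℝ) else 0 := by
    intro j k
    rw [key, intervalIntegral.integral_sub (hint _) (hint _),
      integral_cos_int_mul_pi (n := (j : ℤ) + k + 2) (by omega), sub_zero]
    split_ifs with h
    · simp [h]
    · exact integral_cos_int_mul_pi (by omega)
  exact orthonormal_iff_ite.2 key2

theorem abs_inner_indicatorL2_sineMode_le {A : Set ℝ} (hA : MeasurableSet A) (k : ℕ) :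
    |inner ℝ (indicatorL2 hA) (sineMode k)| ≤ √2 * unitMeasure.real A := by
  rw [inner_indicatorL2, ← Real.norm_eq_abs]
  refine norm_setIntegral_le_of_norm_le_const_ae (measure_lt_top _ _) ?_
  filter_upwards [ae_restrict_of_ae (sineMode_coe k)] with x hx
  rw [hx, norm_mul, Real.norm_of_nonneg (Real.sqrt_nonneg 2)]
  exact mul_le_of_le_one_right (Real.sqrt_nonneg 2) (Real.abs_sin_le_one _)

/-- Decay of the multiplier turns `L²` functions into bounded functions: the modes are bounded by
`√2`, and the multiplier is square summable. -/
theorem supLE_diag {m : ℕ → ℝ} (hm : Summable fun k => m k ^ 2) (f : L2) :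
    SupLE (diag sineMode m f) (√2 * √(∑' k, m k ^ 2) * ‖f‖) := by
  have he := orthonormal_sineMode
  have hb : ∀ k, |m k| ≤ √(∑' k, m k ^ 2) := fun k => by
    rw [← Real.sqrt_sq_eq_abs]
    exact Real.sqrt_le_sqrt (hm.le_tsum k fun _ _ => sq_nonneg _)
  rw [supLE_iff]
  intro A hA
  have h1 := ((hasSum_diag he hb f).mapL (innerSL ℝ (indicatorL2 hA))).tendsto_sum_nat
  simp only [innerSL_apply_apply, inner_smul_right] at h1
  refine le_of_tendsto h1.abs (Filter.Eventually.of_forall fun n => ?_)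
  have h2 : ∑ k ∈ Finset.range n, |m k| * |inner ℝ (sineMode k) f|
      ≤ √(∑' k, m k ^ 2) * ‖f‖ := by
    refine (Real.sum_mul_le_sqrt_mul_sqrt _ _ _).trans ?_
    refine mul_le_mul (Real.sqrt_le_sqrt ?_) ?_ (Real.sqrt_nonneg _) (Real.sqrt_nonneg _)
    · simp only [sq_abs]
      exact hm.sum_le_tsum _ fun _ _ => sq_nonneg _
    · refine Real.sqrt_le_iff.2 ⟨norm_nonneg f, ?_⟩
      have := he.sum_inner_products_le (x := f) (s := Finset.range n)
      simpa [Real.norm_eq_abs] using this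
  calc |∑ k ∈ Finset.range n, m k * inner ℝ (sineMode k) f * inner ℝ (indicatorL2 hA) (sineMode k)|
      ≤ ∑ k ∈ Finset.range n, |m k| * |inner ℝ (sineMode k) f| * (√2 * unitMeasure.real A) := by
        refine (Finset.abs_sum_le_sum_abs _ _).trans (Finset.sum_le_sum fun k _ => ?_)
        rw [abs_mul, abs_mul]
        exact mul_le_mul_of_nonneg_left (abs_inner_indicatorL2_sineMode_le hA k) (by positivity)
    _ = (∑ k ∈ Finset.range n, |m k| * |inner ℝ (sineMode k) f|) * (√2 * unitMeasure.real A) := by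
        rw [Finset.sum_mul]
    _ ≤ (√(∑' k, m k ^ 2) * ‖f‖) * (√2 * unitMeasure.real A) :=
        mul_le_mul_of_nonneg_right h2 (by positivity)
    _ = _ := by ring

theorem exp_neg_le_rpow {x : ℝ} (hx : 0 < x) : Real.exp (-x) ≤ x ^ (-(3 / 4) : ℝ) := by
  have h1 : x ^ (3 / 4 : ℝ) ≤ Real.exp x := by
    rcases le_total x 1 with h | h
    · exact (Real.rpow_le_one hx.le h (by norm_num)).trans (Real.one_le_exp hx.le)
    · calc x ^ (3 / 4 : ℝ) ≤ x ^ (1 : ℝ) := Real.rpow_le_rpow_of_exponent_le h (by norm_num)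
        _ = x := Real.rpow_one x
        _ ≤ Real.exp x := by linarith [Real.add_one_le_exp x]
  rw [Real.exp_neg, Real.rpow_neg hx.le]
  exact inv_anti₀ (Real.rpow_pos_of_pos hx _) h1

/-- The eigenvalues of `-δ d²/dx²` with Dirichlet boundary conditions. -/
noncomputable def eigenvalue (δ : ℝ) (k : ℕ) : ℝ := δ * ((k + 1) * Real.pi) ^ 2

theorem eigenvalue_nonneg {δ : ℝ} (hδ : 0 < δ) (k : ℕ) : 0 ≤ eigenvalue δ k := by
  unfold eigenvalue; positivity

/-- The smoothing property `L² → L^∞`: a multiplier with the decay of the semigroup at time `τ` has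
norm `O(τ^{-3/8})`. The exponent comes from `e^{-x} ≤ x^{-3/4}`. It is not optimal, but `τ^{-3/8}` is
square integrable at `0`, which is all that is needed. -/
theorem exists_supLE_smoothing {δ : ℝ} (hδ : 0 < δ) : ∃ κ : ℝ, 0 ≤ κ ∧ ∀ (τ c : ℝ) (m : ℕ → ℝ)
    (f : L2), 0 < τ → 0 ≤ c → (∀ k, |m k| ≤ c * Real.exp (-(eigenvalue δ k * τ))) →
    SupLE (diag sineMode m f) (κ * c * τ ^ (-(3 / 8) : ℝ) * ‖f‖) := by
  have hz : Summable fun k : ℕ => ((k : ℝ) + 1) ^ (-(3 / 2) : ℝ) := by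
    have := (summable_nat_add_iff 1).2 (Real.summable_nat_rpow.2 (by norm_num : (-(3 / 2) : ℝ) < -1))
    simpa using this
  set ζ := ∑' k : ℕ, ((k : ℝ) + 1) ^ (-(3 / 2) : ℝ) with hζ
  have hζ0 : 0 ≤ ζ := tsum_nonneg fun k => by positivity
  refine ⟨√2 * √(δ ^ (-(3 / 4) : ℝ) * ζ), by positivity, fun τ c m f hτ hc hm => ?_⟩
  have hb : ∀ k, m k ^ 2
      ≤ c ^ 2 * (δ ^ (-(3 / 4) : ℝ) * τ ^ (-(3 / 4) : ℝ)) * ((k : ℝ) + 1) ^ (-(3 / 2) : ℝ) := by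
    intro k
    have hk : (0 : ℝ) < k + 1 := by positivity
    have h1 : δ * τ * ((k : ℝ) + 1) ^ 2 ≤ 2 * (eigenvalue δ k * τ) := by
      have hpi : 1 ≤ Real.pi ^ 2 := by nlinarith [Real.pi_gt_three]
      have : δ * τ * ((k : ℝ) + 1) ^ 2 * 1 ≤ δ * τ * ((k : ℝ) + 1) ^ 2 * Real.pi ^ 2 :=
        mul_le_mul_of_nonneg_left hpi (by positivity)
      have h0 : 0 ≤ δ * τ * ((k : ℝ) + 1) ^ 2 * Real.pi ^ 2 := by positivity
      unfold eigenvalue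
      nlinarith
    calc m k ^ 2 = |m k| ^ 2 := (sq_abs _).symm
      _ ≤ (c * Real.exp (-(eigenvalue δ k * τ))) ^ 2 := pow_le_pow_left₀ (abs_nonneg _) (hm k) 2
      _ = c ^ 2 * Real.exp (-(2 * (eigenvalue δ k * τ))) := by
          rw [mul_pow, ← Real.exp_nat_mul]; push_cast; ring_nf
      _ ≤ c ^ 2 * Real.exp (-(δ * τ * ((k : ℝ) + 1) ^ 2)) := by
          refine mul_le_mul_of_nonneg_left (Real.exp_le_exp.2 (neg_le_neg h1)) (sq_nonneg c)
      _ ≤ c ^ 2 * (δ * τ * ((k : ℝ) + 1) ^ 2) ^ (-(3 / 4) : ℝ) :=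
          mul_le_mul_of_nonneg_left (exp_neg_le_rpow (by positivity)) (sq_nonneg c)
      _ = _ := by
          rw [Real.mul_rpow (by positivity) (by positivity), Real.mul_rpow hδ.le hτ.le,
            ← Real.rpow_natCast ((k : ℝ) + 1), ← Real.rpow_mul hk.le]
          norm_num
          ring
  have hs : Summable fun k => m k ^ 2 :=
    Summable.of_nonneg_of_le (fun k => sq_nonneg _) hb (hz.mul_left _)
  refine (supLE_diag hs f).mono (mul_le_mul_of_nonneg_right ?_ (norm_nonneg f))
  have h2 : ∑' k, m k ^ 2 ≤ (c * τ ^ (-(3 / 8) : ℝ)) ^ 2 * (δ ^ (-(3 / 4) : ℝ) * ζ) := by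
    have h3 := hs.tsum_le_tsum hb (hz.mul_left _)
    rw [tsum_mul_left] at h3
    refine h3.trans (le_of_eq ?_)
    rw [mul_pow, ← Real.rpow_natCast (τ ^ (-(3 / 8) : ℝ)), ← Real.rpow_mul hτ.le]
    norm_num
    ring
  calc √2 * √(∑' k, m k ^ 2)
      ≤ √2 * √((c * τ ^ (-(3 / 8) : ℝ)) ^ 2 * (δ ^ (-(3 / 4) : ℝ) * ζ)) := by gcongr
    _ = _ := by
        rw [Real.sqrt_mul (sq_nonneg _), Real.sqrt_sq (by positivity)]; ring

/-! ### The reaction term -/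

/-- What the estimates use of the reaction term `φ ↦ -δ⁻¹ V'(φ)`: it is bounded and Lipschitz on
`L²(0,1)`, and its second differences are quadratic in the *essential supremum* of the difference of
the arguments (not in the `L²` norm: superposition operators on `L²` are not of class `C^{1,1}`). -/
structure IsRegularReaction (F : L2 → L2) (M : ℝ) : Prop where
  nonneg : 0 ≤ M
  bound : ∀ z, ‖F z‖ ≤ M
  lipschitz : ∀ z w, ‖F z - F w‖ ≤ M * ‖z - w‖
  second : ∀ (z w : L2) (r ρ : ℝ), r ∈ Icc (0 : ℝ) 1 → SupLE (z - w) ρ →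
    ‖r • F z + (1 - r) • F w - F (r • z + (1 - r) • w)‖ ≤ M * (r * (1 - r)) * ρ ^ 2

theorem L2.norm_le_of_ae_abs_le {h : L2} {c : ℝ} (hc : 0 ≤ c)
    (hh : ∀ᵐ x ∂unitMeasure, |h x| ≤ c) : ‖h‖ ≤ c := by
  have := Lp.norm_le_of_ae_bound (f := h) hc (by simpa only [Real.norm_eq_abs] using hh)
  simpa [measureUnivNNReal] using this

theorem superposition_coe {f : ℝ → ℝ} {M : ℝ} (hf : Continuous f) (hM : ∀ y, |f y| ≤ M) (z : L2) :
    superposition f z =ᵐ[unitMeasure] fun x => f (z x) := by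
  have h : MemLp (fun x => f (z x)) 2 unitMeasure :=
    MemLp.of_bound (C := M) (hf.comp_aestronglyMeasurable (Lp.aestronglyMeasurable z))
      (Filter.Eventually.of_forall fun x => hM _)
  rw [superposition, dif_pos h]
  exact h.coeFn_toLp

/-- The reaction term `φ ↦ -δ⁻¹ V'(φ)` on `L²(0,1)`. -/
noncomputable def reaction (δ : ℝ) (V : ℝ → ℝ) (z : L2) : L2 := -(δ⁻¹ • superposition (deriv V) z)

theorem exists_isRegularReaction {δ : ℝ} {V : ℝ → ℝ} (hδ : 0 < δ) (hV : ContDiff ℝ 3 V)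
    (hVb : ∀ k ∈ ({1, 2, 3} : Set ℕ), ∃ M : ℝ, ∀ y : ℝ, |iteratedDeriv k V y| ≤ M) :
    ∃ M, IsRegularReaction (reaction δ V) M := by
  obtain ⟨M₁, h₁⟩ := hVb 1 (by simp)
  obtain ⟨M₂, h₂⟩ := hVb 2 (by simp)
  obtain ⟨M₃, h₃⟩ := hVb 3 (by simp)
  rw [iteratedDeriv_one] at h₁
  have n₁ : 0 ≤ M₁ := (abs_nonneg _).trans (h₁ 0)
  have n₂ : 0 ≤ M₂ := (abs_nonneg _).trans (h₂ 0)
  have n₃ : 0 ≤ M₃ := (abs_nonneg _).trans (h₃ 0)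
  have hc : Continuous (deriv V) := hV.continuous_deriv (by norm_num)
  have d₁ : ∀ x ∈ univ, HasDerivAt (deriv V) (iteratedDeriv 2 V x) x := fun x _ => by
    have h := (hV.differentiable_iteratedDeriv 1 (by norm_num) x).hasDerivAt
    rwa [← iteratedDeriv_succ, iteratedDeriv_one] at h
  have d₂ : ∀ x ∈ univ, HasDerivAt (iteratedDeriv 2 V) (iteratedDeriv 3 V x) x := fun x _ => by
    have h := (hV.differentiable_iteratedDeriv 2 (by norm_num) x).hasDerivAt
    rwa [← iteratedDeriv_succ] at h
  have l₁ : ∀ x y, |deriv V x - deriv V y| ≤ M₂ * |x - y| := fun x y => by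
    obtain ⟨ξ, -, h⟩ := exists_sub_eq_mul_sub ordConnected_univ d₁ (mem_univ x) (mem_univ y)
    rw [h, abs_mul]
    exact mul_le_mul_of_nonneg_right (h₂ ξ) (abs_nonneg _)
  have l₂ : ∀ x ∈ univ, ∀ y ∈ univ, |iteratedDeriv 2 V x - iteratedDeriv 2 V y| ≤ M₃ * |x - y| :=
    fun x _ y _ => by
      obtain ⟨ξ, -, h⟩ := exists_sub_eq_mul_sub ordConnected_univ d₂ (mem_univ x) (mem_univ y)
      rw [h, abs_mul]
      exact mul_le_mul_of_nonneg_right (h₃ ξ) (abs_nonneg _)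
  have hcoe := superposition_coe hc h₁
  have hδ' : 0 ≤ δ⁻¹ := (inv_pos.2 hδ).le
  have e₁ : δ⁻¹ * M₁ ≤ δ⁻¹ * (M₁ + M₂ + M₃) := mul_le_mul_of_nonneg_left (by linarith) hδ'
  have e₂ : δ⁻¹ * M₂ ≤ δ⁻¹ * (M₁ + M₂ + M₃) := mul_le_mul_of_nonneg_left (by linarith) hδ'
  have e₃ : δ⁻¹ * M₃ ≤ δ⁻¹ * (M₁ + M₂ + M₃) := mul_le_mul_of_nonneg_left (by linarith) hδ'
  refine ⟨δ⁻¹ * (M₁ + M₂ + M₃), ⟨by positivity, fun z => ?_, fun z w => ?_, ?_⟩⟩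
  · rw [reaction, norm_neg, norm_smul, Real.norm_of_nonneg hδ']
    refine le_trans (mul_le_mul_of_nonneg_left (L2.norm_le_of_ae_abs_le n₁ ?_) hδ') e₁
    filter_upwards [hcoe z] with x hx
    rw [hx]; exact h₁ _
  · have h : reaction δ V z - reaction δ V w
        = -(δ⁻¹ • (superposition (deriv V) z - superposition (deriv V) w)) := by
      rw [reaction, reaction]; module
    rw [h, norm_neg, norm_smul, Real.norm_of_nonneg hδ']
    refine le_trans ?_ (mul_le_mul_of_nonneg_right e₂ (norm_nonneg _))
    rw [mul_assoc]
    refine mul_le_mul_of_nonneg_left (Lp.norm_le_mul_norm_of_ae_le_mul ?_) hδ'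
    filter_upwards [hcoe z, hcoe w, Lp.coeFn_sub z w,
      Lp.coeFn_sub (superposition (deriv V) z) (superposition (deriv V) w)] with x hz hw h3 h4
    rw [h4, h3, Pi.sub_apply, Pi.sub_apply, hz, hw, Real.norm_eq_abs, Real.norm_eq_abs]
    exact l₁ _ _
  · intro z w r ρ hr hρ
    have hrr : 0 ≤ r * (1 - r) := mul_nonneg hr.1 (by linarith [hr.2])
    have h : r • reaction δ V z + (1 - r) • reaction δ V w - reaction δ V (r • z + (1 - r) • w)
        = -(δ⁻¹ • (r • superposition (deriv V) z + (1 - r) • superposition (deriv V) w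
          - superposition (deriv V) (r • z + (1 - r) • w))) := by
      simp only [reaction]; module
    rw [h, norm_neg, norm_smul, Real.norm_of_nonneg hδ']
    have e : δ⁻¹ * (M₃ * (r * (1 - r)) * ρ ^ 2)
        ≤ δ⁻¹ * (M₁ + M₂ + M₃) * (r * (1 - r)) * ρ ^ 2 := by
      have := mul_le_mul_of_nonneg_right e₃ (mul_nonneg hrr (sq_nonneg ρ))
      linarith
    refine le_trans (mul_le_mul_of_nonneg_left ?_ hδ') e
    refine L2.norm_le_of_ae_abs_le (by positivity) ?_
    set z' := superposition (deriv V) z with hz'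
    set w' := superposition (deriv V) w with hw'
    set c' := superposition (deriv V) (r • z + (1 - r) • w) with hc'
    filter_upwards [hcoe z, hcoe w, hcoe (r • z + (1 - r) • w), hρ.ae_abs_le, Lp.coeFn_sub z w,
      Lp.coeFn_add (r • z) ((1 - r) • w), Lp.coeFn_smul r z, Lp.coeFn_smul (1 - r) w,
      Lp.coeFn_sub (r • z' + (1 - r) • w') c', Lp.coeFn_add (r • z') ((1 - r) • w'),
      Lp.coeFn_smul r z', Lp.coeFn_smul (1 - r) w']
      with x a1 a2 a3 a4 a5 a6 a7 a8 a9 a10 a11 a12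
    rw [a9, Pi.sub_apply, a10, Pi.add_apply, a11, a12, a3, a6, Pi.add_apply, a7, a8]
    simp only [Pi.smul_apply, smul_eq_mul]
    rw [a1, a2]
    rw [a5, Pi.sub_apply] at a4
    refine (abs_second_difference_le ordConnected_univ n₃ d₁ l₂ (mem_univ _) (mem_univ _) hr).trans
      (mul_le_mul_of_nonneg_left ?_ (by positivity))
    rw [← sq_abs (z x - w x)]
    exact pow_le_pow_left₀ (abs_nonneg _) a4 2

theorem IsRegularReaction.continuous {F : L2 → L2} {M : ℝ} (hF : IsRegularReaction F M) :
    Continuous F := by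
  refine (LipschitzWith.of_dist_le_mul (K := ⟨M, hF.nonneg⟩) fun z w => ?_).continuous
  rw [dist_eq_norm, dist_eq_norm]
  exact hF.lipschitz z w

/-! ### The heat semigroup -/

theorem heatSemigroup_eq_diag (δ t : ℝ) (f : L2) :
    heatSemigroup δ t f = diag sineMode (fun k => Real.exp (-(eigenvalue δ k * t))) f := rfl

theorem abs_exp_eigenvalue_le_one {δ t : ℝ} (hδ : 0 < δ) (ht : 0 ≤ t) (k : ℕ) :
    |Real.exp (-(eigenvalue δ k * t))| ≤ 1 := by
  rw [Real.abs_exp]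
  exact Real.exp_le_one_iff.2 (neg_nonpos.2 (mul_nonneg (eigenvalue_nonneg hδ k) ht))

theorem norm_heatSemigroup_le {δ t : ℝ} (hδ : 0 < δ) (ht : 0 ≤ t) (f : L2) :
    ‖heatSemigroup δ t f‖ ≤ ‖f‖ := by
  have := norm_diag_le orthonormal_sineMode zero_le_one (abs_exp_eigenvalue_le_one hδ ht) f
  rwa [one_mul] at this

theorem heatSemigroup_sub {δ t : ℝ} (hδ : 0 < δ) (ht : 0 ≤ t) (f g : L2) :
    heatSemigroup δ t (f - g) = heatSemigroup δ t f - heatSemigroup δ t g :=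
  diag_sub orthonormal_sineMode (abs_exp_eigenvalue_le_one hδ ht) f g

theorem heatSemigroup_smul (δ t a : ℝ) (f : L2) :
    heatSemigroup δ t (a • f) = a • heatSemigroup δ t f :=
  diag_smul _ _ _ _

theorem tendsto_heatSemigroup {α : Type*} {l : Filter α} {δ t₀ : ℝ} {t : α → ℝ} (hδ : 0 < δ)
    (ht₀ : 0 ≤ t₀) (ht : ∀ᶠ x in l, 0 ≤ t x) (h : Filter.Tendsto t l (nhds t₀)) (f : L2) :
    Filter.Tendsto (fun x => heatSemigroup δ (t x) f) l (nhds (heatSemigroup δ t₀ f)) := by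
  refine tendsto_diag orthonormal_sineMode (c := 1) ?_ (abs_exp_eigenvalue_le_one hδ ht₀)
    (fun k => ?_) f
  · filter_upwards [ht] with x hx
    exact abs_exp_eigenvalue_le_one hδ hx
  · exact (Real.continuous_exp.tendsto _).comp (h.const_mul _).neg

theorem integrable_heatSemigroup {δ : ℝ} (hδ : 0 < δ) {μ : Measure ℝ} {τ : ℝ → ℝ}
    (hτ : Measurable τ) (h0 : ∀ᵐ s ∂μ, 0 ≤ τ s) {f : ℝ → L2} (hf : Integrable f μ) :
    Integrable (fun s => heatSemigroup δ (τ s) (f s)) μ := by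
  refine integrable_diag (c := 1) orthonormal_sineMode zero_le_one (fun k => ?_) ?_ hf
  · fun_prop
  · filter_upwards [h0] with s hs
    exact abs_exp_eigenvalue_le_one hδ hs

theorem intervalIntegrable_heatSemigroup {δ p q : ℝ} (hδ : 0 < δ) (hpq : p ≤ q) {τ : ℝ → ℝ}
    (hτ : Measurable τ) (h0 : ∀ s ∈ Ioc p q, 0 ≤ τ s) {f : ℝ → L2}
    (hf : IntervalIntegrable f volume p q) :
    IntervalIntegrable (fun s => heatSemigroup δ (τ s) (f s)) volume p q := by
  rw [intervalIntegrable_iff_integrableOn_Ioc_of_le hpq] at hf ⊢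
  exact integrable_heatSemigroup hδ hτ
    ((ae_restrict_iff' measurableSet_Ioc).2 (Filter.Eventually.of_forall h0)) hf

/-- The Duhamel integral is continuous in time, by dominated convergence. The integrand
`1_{s < t} S(t - s) f(s)` is continuous in `t` except at `t = s`. -/
theorem continuousOn_duhamel {δ t₀ T : ℝ} (hδ : 0 < δ) {f : ℝ → L2}
    (hf : IntegrableOn f (Ioc t₀ T)) :
    ContinuousOn (fun t => ∫ s in t₀..t, heatSemigroup δ (t - s) (f s)) (Icc t₀ T) := by
  have h : Continuous fun t => ∫ s in Ioc t₀ T,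
      (Iio t).indicator (fun s => heatSemigroup δ (t - s) (f s)) s := by
    refine continuous_iff_continuousAt.2 fun t => ?_
    refine continuousAt_of_dominated (bound := fun s => ‖f s‖)
      (Filter.Eventually.of_forall fun x => ?_) (Filter.Eventually.of_forall fun x => ?_)
      hf.norm ?_
    · rw [aestronglyMeasurable_indicator_iff measurableSet_Iio]
      refine (integrable_heatSemigroup hδ (τ := fun s => x - s) (by fun_prop) ?_
        (Integrable.restrict (μ := volume.restrict (Ioc t₀ T)) hf)).1
      refine (ae_restrict_iff' measurableSet_Iio).2 (Filter.Eventually.of_forall fun s hs => ?_)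
      exact sub_nonneg.2 (le_of_lt hs)
    · refine Filter.Eventually.of_forall fun s => ?_
      by_cases hs : s ∈ Iio x
      · rw [indicator_of_mem hs]
        exact norm_heatSemigroup_le hδ (sub_nonneg.2 (le_of_lt hs)) _
      · rw [indicator_of_notMem hs, norm_zero]
        exact norm_nonneg _
    · have hne : ∀ᵐ s ∂(volume.restrict (Ioc t₀ T)), s ≠ t :=
        ae_restrict_of_ae (by simp [ae_iff])
      filter_upwards [hne] with s hs
      rcases lt_or_gt_of_ne hs with h | h
      · have h1 : ContinuousAt (fun x => heatSemigroup δ (x - s) (f s)) t := by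
          refine tendsto_heatSemigroup hδ (sub_nonneg.2 h.le) ?_
            ((continuous_id.sub continuous_const).tendsto t) (f s)
          filter_upwards [eventually_gt_nhds h] with x hx
          exact sub_nonneg.2 (le_of_lt hx)
        refine h1.congr ?_
        filter_upwards [eventually_gt_nhds h] with x hx
        rw [indicator_of_mem (show s ∈ Iio x from hx)]
      · refine (continuousAt_const (y := (0 : L2))).congr ?_
        filter_upwards [eventually_lt_nhds h] with x hx
        rw [indicator_of_notMem (show s ∉ Iio x from fun h' => lt_asymm hx h')]
  -- the single point `s = t`, where the two integrands differ, is negligible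
  refine h.continuousOn.congr fun t ht => ?_
  beta_reduce
  rw [setIntegral_indicator measurableSet_Iio, intervalIntegral.integral_of_le ht.1,
    integral_Ioc_eq_integral_Ioo]
  congr 2
  ext s
  exact ⟨fun hs => ⟨⟨hs.1, hs.2.le.trans ht.2⟩, hs.2⟩, fun hs => ⟨hs.1.1, hs.2⟩⟩

/-! ### Existence of mild solutions -/

theorem integral_mul_sub_pow_div_factorial (M t₀ t : ℝ) (n : ℕ) :
    ∫ s in t₀..t, M * ((M * (s - t₀)) ^ n / n.factorial)
      = (M * (t - t₀)) ^ (n + 1) / (n + 1).factorial := by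
  have h : ∀ s ∈ uIcc t₀ t, HasDerivAt
      (fun s => (M * (s - t₀)) ^ (n + 1) / (n + 1).factorial)
      (M * ((M * (s - t₀)) ^ n / n.factorial)) s := fun s _ => by
    have h1 := ((((hasDerivAt_id s).sub_const t₀).const_mul M).pow (n + 1)).div_const
      ((n + 1).factorial : ℝ)
    refine h1.congr_deriv ?_
    have : (n.factorial : ℝ) ≠ 0 := by positivity
    have : (n + 1 : ℝ) ≠ 0 := by positivity
    rw [Nat.factorial_succ, Nat.add_sub_cancel]
    dsimp only [id]
    push_cast
    field_simp
  rw [intervalIntegral.integral_eq_sub_of_hasDerivAt h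
    ((by fun_prop : Continuous fun s => M * ((M * (s - t₀)) ^ n / n.factorial)).intervalIntegrable
      _ _)]
  simp

/-- Picard iteration: the `n`-th iterate of the fixed point map on `C([t₀,T]; L²)` has the Lipschitz
constant `(M (T - t₀))ⁿ / n!`, and is a contraction for large `n`. -/
theorem exists_mildSolution {δ : ℝ} (hδ : 0 < δ) {F : L2 → L2} {M : ℝ}
    (hF : IsRegularReaction F M) {t₀ T : ℝ} (hT : t₀ ≤ T) {α : ℝ → L2}
    (hα : IntegrableOn α (Ioc t₀ T)) (φ₀ : L2) :
    ∃ φ : ℝ → L2, ContinuousOn φ (Icc t₀ T) ∧ ∀ t ∈ Icc t₀ T,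
      φ t = heatSemigroup δ (t - t₀) φ₀
        + ∫ s in t₀..t, heatSemigroup δ (t - s) (F (φ s) + α s) := by
  have hint : ∀ u : C(Icc t₀ T, L2),
      IntegrableOn (fun s => F (IccExtend hT u s) + α s) (Ioc t₀ T) := fun u =>
    ((hF.continuous.comp u.continuous.Icc_extend').integrableOn_Ioc).add hα
  have hii : ∀ (u : C(Icc t₀ T, L2)) (t : ℝ), t ∈ Icc t₀ T → IntervalIntegrable
      (fun s => heatSemigroup δ (t - s) (F (IccExtend hT u s) + α s)) volume t₀ t := by
    intro u t ht
    refine intervalIntegrable_heatSemigroup hδ ht.1 (by fun_prop)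
      (fun s hs => sub_nonneg.2 hs.2) ?_
    rw [intervalIntegrable_iff_integrableOn_Ioc_of_le ht.1]
    exact (hint u).mono_set (Ioc_subset_Ioc_right ht.2)
  let Φ : C(Icc t₀ T, L2) → C(Icc t₀ T, L2) := fun u =>
    ⟨(Icc t₀ T).domRestrict (fun t => heatSemigroup δ (t - t₀) φ₀
        + ∫ s in t₀..t, heatSemigroup δ (t - s) (F (IccExtend hT u s) + α s)), by
      refine ContinuousOn.domRestrict (ContinuousOn.add (fun t ht => ?_)
        (continuousOn_duhamel hδ (hint u)))
      refine tendsto_heatSemigroup hδ (sub_nonneg.2 ht.1) ?_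
        ((continuous_id.sub continuous_const).continuousWithinAt) φ₀
      filter_upwards [self_mem_nhdsWithin] with x hx
      exact sub_nonneg.2 hx.1⟩
  have hΦ : ∀ u (t : Icc t₀ T), Φ u t = heatSemigroup δ (t - t₀) φ₀
      + ∫ s in t₀..t, heatSemigroup δ (t - s) (F (IccExtend hT u s) + α s) := fun u t => rfl
  have hiter : ∀ (n : ℕ) (u v : C(Icc t₀ T, L2)) (t : Icc t₀ T),
      ‖Φ^[n] u t - Φ^[n] v t‖ ≤ (M * (t - t₀)) ^ n / n.factorial * dist u v := by
    intro n
    induction n with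
    | zero =>
      intro u v t
      simpa [dist_eq_norm] using ContinuousMap.dist_apply_le_dist (f := u) (g := v) t
    | succ n ih =>
      intro u v t
      rw [Function.iterate_succ_apply', Function.iterate_succ_apply']
      set u' := Φ^[n] u
      set v' := Φ^[n] v
      rw [hΦ, hΦ, add_sub_add_left_eq_sub,
        ← intervalIntegral.integral_sub (hii u' t t.2) (hii v' t t.2),
        ← integral_mul_sub_pow_div_factorial, ← intervalIntegral.integral_mul_const]
      refine intervalIntegral.norm_integral_le_of_norm_le t.2.1 ?_
        ((by fun_prop : Continuous fun s : ℝ =>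
          M * ((M * (s - t₀)) ^ n / n.factorial) * dist u v).intervalIntegrable _ _)
      refine Filter.Eventually.of_forall fun s hs => ?_
      have hs' : s ∈ Icc t₀ T := ⟨hs.1.le, hs.2.trans t.2.2⟩
      have hts : 0 ≤ (t : ℝ) - s := sub_nonneg.2 hs.2
      rw [← heatSemigroup_sub hδ hts, add_sub_add_right_eq_sub, IccExtend_of_mem hT _ hs',
        IccExtend_of_mem hT _ hs']
      refine (norm_heatSemigroup_le hδ hts _).trans ((hF.lipschitz _ _).trans ?_)
      rw [mul_assoc]
      exact mul_le_mul_of_nonneg_left (ih u v ⟨s, hs'⟩) hF.nonneg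
  obtain ⟨n, hn⟩ := ((FloorSemiring.tendsto_pow_div_factorial_atTop (M * (T - t₀))).eventually
    (gt_mem_nhds (zero_lt_one (α := ℝ)))).exists
  have hn0 : 0 ≤ (M * (T - t₀)) ^ n / n.factorial := by
    have := mul_nonneg hF.nonneg (sub_nonneg.2 hT)
    positivity
  have hcontr : ContractingWith ⟨_, hn0⟩ Φ^[n] := by
    refine ⟨by exact_mod_cast hn, LipschitzWith.of_dist_le_mul fun u v => ?_⟩
    refine (ContinuousMap.dist_le (by positivity)).2 fun t => ?_
    rw [dist_eq_norm]
    refine (hiter n u v t).trans (mul_le_mul_of_nonneg_right ?_ dist_nonneg)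
    have h1 : M * (t - t₀) ≤ M * (T - t₀) :=
      mul_le_mul_of_nonneg_left (sub_le_sub_right t.2.2 t₀) hF.nonneg
    have h2 : 0 ≤ M * ((t : ℝ) - t₀) := mul_nonneg hF.nonneg (sub_nonneg.2 t.2.1)
    exact div_le_div_of_nonneg_right (pow_le_pow_left₀ h2 h1 n) (by positivity)
  set u := ContractingWith.fixedPoint Φ^[n] hcontr with hu
  have hfix : Φ u = u := hcontr.isFixedPt_fixedPoint_iterate
  refine ⟨IccExtend hT u, u.continuous.Icc_extend'.continuousOn, fun t ht => ?_⟩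
  have h := hΦ u ⟨t, ht⟩
  rw [hfix] at h
  rw [IccExtend_of_mem hT _ ht]
  exact h

/-! ### Dependence of the heat semigroup on the time scale -/

section TimeScale

variable {δ l L₁ L₂ τ : ℝ}

theorem abs_multiplier_sub_le (hδ : 0 < δ) (hl : 0 < l) (h₁ : l ≤ L₁) (h₂ : l ≤ L₂) (hτ : 0 ≤ τ)
    (k : ℕ) : |Real.exp (-(eigenvalue δ k * (L₁ * τ))) - Real.exp (-(eigenvalue δ k * (L₂ * τ)))|
      ≤ 2 / l * |L₁ - L₂| * Real.exp (-(eigenvalue δ k * (l / 2 * τ))) := by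
  have h := abs_exp_neg_sub_exp_neg_le (mul_nonneg (eigenvalue_nonneg hδ k) hτ) hl h₁ h₂
  convert h using 4 <;> ring_nf

theorem norm_heatSemigroup_sub_le (hδ : 0 < δ) (hl : 0 < l) (h₁ : l ≤ L₁) (h₂ : l ≤ L₂)
    (hτ : 0 ≤ τ) (f : L2) :
    ‖heatSemigroup δ (L₁ * τ) f - heatSemigroup δ (L₂ * τ) f‖ ≤ 2 / l * |L₁ - L₂| * ‖f‖ := by
  rw [heatSemigroup_eq_diag, heatSemigroup_eq_diag, diag_sub_multiplier orthonormal_sineMode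
    (abs_exp_eigenvalue_le_one hδ (mul_nonneg (hl.le.trans h₁) hτ))
    (abs_exp_eigenvalue_le_one hδ (mul_nonneg (hl.le.trans h₂) hτ))]
  refine norm_diag_le orthonormal_sineMode (by positivity) (fun k => ?_) f
  refine (abs_multiplier_sub_le hδ hl h₁ h₂ hτ k).trans ?_
  refine mul_le_of_le_one_right (by positivity) ?_
  have := abs_exp_eigenvalue_le_one hδ (mul_nonneg (half_pos hl).le hτ) k
  rwa [Real.abs_exp] at this

/-- In terms of the time scale `L`, the operators `S(Lτ)` have a second derivative that is bounded
uniformly in `τ ≥ 0`, because the semigroup is analytic. -/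
theorem norm_second_difference_heatSemigroup_le (hδ : 0 < δ) (hl : 0 < l) (h₁ : l ≤ L₁)
    (h₂ : l ≤ L₂) (hτ : 0 ≤ τ) {r : ℝ} (hr : r ∈ Icc (0 : ℝ) 1) (f : L2) :
    ‖r • heatSemigroup δ (L₁ * τ) f + (1 - r) • heatSemigroup δ (L₂ * τ) f
        - heatSemigroup δ ((r * L₁ + (1 - r) * L₂) * τ) f‖
      ≤ (2 / l) ^ 2 * (r * (1 - r)) * (L₁ - L₂) ^ 2 * ‖f‖ := by
  have hr' : 0 ≤ 1 - r := by linarith [hr.2]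
  have b₁ := abs_exp_eigenvalue_le_one hδ (mul_nonneg (hl.le.trans h₁) hτ)
  have b₂ := abs_exp_eigenvalue_le_one hδ (mul_nonneg (hl.le.trans h₂) hτ)
  have b₃ := abs_exp_eigenvalue_le_one hδ (t := (r * L₁ + (1 - r) * L₂) * τ) (mul_nonneg
    (add_nonneg (mul_nonneg hr.1 (hl.le.trans h₁)) (mul_nonneg hr' (hl.le.trans h₂))) hτ)
  have h := (((hasSum_diag orthonormal_sineMode b₁ f).const_smul r).add
    ((hasSum_diag orthonormal_sineMode b₂ f).const_smul (1 - r))).sub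
    (hasSum_diag orthonormal_sineMode b₃ f)
  have key : ∀ k, |r * Real.exp (-(eigenvalue δ k * (L₁ * τ)))
      + (1 - r) * Real.exp (-(eigenvalue δ k * (L₂ * τ)))
      - Real.exp (-(eigenvalue δ k * ((r * L₁ + (1 - r) * L₂) * τ)))|
      ≤ (2 / l) ^ 2 * (r * (1 - r)) * (L₁ - L₂) ^ 2 := fun k => by
    have := abs_second_difference_exp_le (mul_nonneg (eigenvalue_nonneg hδ k) hτ) hl h₁ h₂ hr
    convert this using 4 <;> ring_nf
  have h' := hasSum_diag orthonormal_sineMode key f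
  have e := h.unique (by convert h' using 2 with k; module)
  rw [heatSemigroup_eq_diag, heatSemigroup_eq_diag, heatSemigroup_eq_diag, e]
  exact norm_diag_le orthonormal_sineMode
    (by have := mul_nonneg hr.1 hr'; positivity) key f

/-- The second difference of `(L, f) ↦ S(Lτ) f`. -/
theorem norm_second_difference_heatSemigroup_apply_le (hδ : 0 < δ) (hl : 0 < l) (h₁ : l ≤ L₁)
    (h₂ : l ≤ L₂) (hτ : 0 ≤ τ) {r : ℝ} (hr : r ∈ Icc (0 : ℝ) 1) (f₁ f₂ : L2) :
    ‖r • heatSemigroup δ (L₁ * τ) f₁ + (1 - r) • heatSemigroup δ (L₂ * τ) f₂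
        - heatSemigroup δ ((r * L₁ + (1 - r) * L₂) * τ) (r • f₁ + (1 - r) • f₂)‖
      ≤ r * (1 - r) * ((2 / l) ^ 2 * |L₁ - L₂| ^ 2 * ‖r • f₁ + (1 - r) • f₂‖
        + 2 / l * |L₁ - L₂| * ‖f₁ - f₂‖) := by
  have hr' : 0 ≤ r * (1 - r) := mul_nonneg hr.1 (by linarith [hr.2])
  have p₁ : 0 ≤ L₁ * τ := mul_nonneg (hl.le.trans h₁) hτ
  have p₂ : 0 ≤ L₂ * τ := mul_nonneg (hl.le.trans h₂) hτ
  have s₁ : heatSemigroup δ (L₁ * τ) f₁ = heatSemigroup δ (L₁ * τ) (r • f₁ + (1 - r) • f₂)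
      + (1 - r) • heatSemigroup δ (L₁ * τ) (f₁ - f₂) := by
    have := heatSemigroup_sub hδ p₁ f₁ (r • f₁ + (1 - r) • f₂)
    rw [show f₁ - (r • f₁ + (1 - r) • f₂) = (1 - r) • (f₁ - f₂) by module,
      heatSemigroup_smul] at this
    rw [this]; abel
  have s₂ : heatSemigroup δ (L₂ * τ) f₂ = heatSemigroup δ (L₂ * τ) (r • f₁ + (1 - r) • f₂)
      + (-r) • heatSemigroup δ (L₂ * τ) (f₁ - f₂) := by
    have := heatSemigroup_sub hδ p₂ f₂ (r • f₁ + (1 - r) • f₂)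
    rw [show f₂ - (r • f₁ + (1 - r) • f₂) = (-r) • (f₁ - f₂) by module,
      heatSemigroup_smul] at this
    rw [this]; abel
  have e : r • heatSemigroup δ (L₁ * τ) f₁ + (1 - r) • heatSemigroup δ (L₂ * τ) f₂
        - heatSemigroup δ ((r * L₁ + (1 - r) * L₂) * τ) (r • f₁ + (1 - r) • f₂)
      = (r • heatSemigroup δ (L₁ * τ) (r • f₁ + (1 - r) • f₂)
          + (1 - r) • heatSemigroup δ (L₂ * τ) (r • f₁ + (1 - r) • f₂)
          - heatSemigroup δ ((r * L₁ + (1 - r) * L₂) * τ) (r • f₁ + (1 - r) • f₂))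
        + (r * (1 - r)) • (heatSemigroup δ (L₁ * τ) (f₁ - f₂)
          - heatSemigroup δ (L₂ * τ) (f₁ - f₂)) := by
    rw [s₁, s₂]; module
  rw [e]
  refine (norm_add_le _ _).trans ?_
  rw [norm_smul, Real.norm_of_nonneg hr']
  have g₁ := norm_second_difference_heatSemigroup_le hδ hl h₁ h₂ hτ hr (r • f₁ + (1 - r) • f₂)
  have g₂ := mul_le_mul_of_nonneg_left (norm_heatSemigroup_sub_le hδ hl h₁ h₂ hτ (f₁ - f₂)) hr'
  rw [← sq_abs (L₁ - L₂)] at g₁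
  linarith

theorem norm_heatSemigroup_apply_sub_le (hδ : 0 < δ) (hl : 0 < l) (h₁ : l ≤ L₁) (h₂ : l ≤ L₂)
    (hτ : 0 ≤ τ) (f₁ f₂ : L2) :
    ‖heatSemigroup δ (L₁ * τ) f₁ - heatSemigroup δ (L₂ * τ) f₂‖
      ≤ ‖f₁ - f₂‖ + 2 / l * |L₁ - L₂| * ‖f₂‖ := by
  have p₁ : 0 ≤ L₁ * τ := mul_nonneg (hl.le.trans h₁) hτ
  have e : heatSemigroup δ (L₁ * τ) f₁ - heatSemigroup δ (L₂ * τ) f₂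
      = heatSemigroup δ (L₁ * τ) (f₁ - f₂)
        + (heatSemigroup δ (L₁ * τ) f₂ - heatSemigroup δ (L₂ * τ) f₂) := by
    rw [heatSemigroup_sub hδ p₁]; abel
  rw [e]
  exact (norm_add_le _ _).trans (add_le_add (norm_heatSemigroup_le hδ p₁ _)
    (norm_heatSemigroup_sub_le hδ hl h₁ h₂ hτ f₂))

/-- The smoothing property for the difference of two applications of the semigroup, with the dependence
on the time scale. -/
theorem exists_supLE_heatSemigroup_apply_sub (hδ : 0 < δ) (hl : 0 < l) :
    ∃ κ : ℝ, 0 ≤ κ ∧ ∀ (L₁ L₂ τ : ℝ) (f₁ f₂ : L2), l ≤ L₁ → l ≤ L₂ → 0 < τ →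
      SupLE (heatSemigroup δ (L₁ * τ) f₁ - heatSemigroup δ (L₂ * τ) f₂)
        (κ * τ ^ (-(3 / 8) : ℝ) * (‖f₁ - f₂‖ + 2 / l * |L₁ - L₂| * ‖f₂‖)) := by
  obtain ⟨κ, hκ, h⟩ := exists_supLE_smoothing hδ
  refine ⟨κ * (l / 2) ^ (-(3 / 8) : ℝ), by positivity, fun L₁ L₂ τ f₁ f₂ h₁ h₂ hτ => ?_⟩
  have p₁ : 0 ≤ L₁ * τ := mul_nonneg (hl.le.trans h₁) hτ.le
  have p₂ : 0 ≤ L₂ * τ := mul_nonneg (hl.le.trans h₂) hτ.le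
  have e : heatSemigroup δ (L₁ * τ) f₁ - heatSemigroup δ (L₂ * τ) f₂
      = heatSemigroup δ (L₁ * τ) (f₁ - f₂)
        + diag sineMode (fun k => Real.exp (-(eigenvalue δ k * (L₁ * τ)))
            - Real.exp (-(eigenvalue δ k * (L₂ * τ)))) f₂ := by
    rw [← diag_sub_multiplier orthonormal_sineMode (abs_exp_eigenvalue_le_one hδ p₁)
      (abs_exp_eigenvalue_le_one hδ p₂), ← heatSemigroup_eq_diag, ← heatSemigroup_eq_diag,
      heatSemigroup_sub hδ p₁]
    abel
  have g₁ := h (l / 2 * τ) 1 (fun k => Real.exp (-(eigenvalue δ k * (L₁ * τ)))) (f₁ - f₂)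
    (by positivity) zero_le_one (fun k => by
      rw [one_mul, Real.abs_exp]
      refine Real.exp_le_exp.2 (neg_le_neg (mul_le_mul_of_nonneg_left ?_ (eigenvalue_nonneg hδ k)))
      exact mul_le_mul_of_nonneg_right (by linarith) hτ.le)
  have g₂ := h (l / 2 * τ) (2 / l * |L₁ - L₂|) _ f₂ (by positivity) (by positivity)
    (abs_multiplier_sub_le hδ hl h₁ h₂ hτ.le)
  rw [e]
  refine (g₁.add g₂).mono (le_of_eq ?_)
  rw [Real.mul_rpow (half_pos hl).le hτ.le]
  ring

end TimeScale

/-! ### The equation on the unit time interval -/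

/-- The integral form of Grönwall's inequality on `[0,1]`. -/
theorem le_mul_exp_of_le_add_integral {n : ℝ → ℝ} {A c : ℝ} (hn : ContinuousOn n (Icc 0 1))
    (hc : 0 ≤ c) (h : ∀ σ ∈ Icc (0 : ℝ) 1, n σ ≤ A + c * ∫ s in (0 : ℝ)..σ, n s) :
    ∀ σ ∈ Icc (0 : ℝ) 1, n σ ≤ A * Real.exp (c * σ) := by
  set n' : ℝ → ℝ := IccExtend zero_le_one ((Icc (0 : ℝ) 1).domRestrict n) with hn'
  have hcont : Continuous n' := hn.domRestrict.Icc_extend'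
  have heq : ∀ s ∈ Icc (0 : ℝ) 1, n' s = n s := fun s hs => by
    rw [hn', IccExtend_of_mem _ _ hs, domRestrict_apply]
  have hint : ∀ σ ∈ Icc (0 : ℝ) 1, ∫ s in (0 : ℝ)..σ, n s = ∫ s in (0 : ℝ)..σ, n' s := by
    intro σ hσ
    refine intervalIntegral.integral_congr fun s hs => (heq s ?_).symm
    rw [uIcc_of_le hσ.1] at hs
    exact ⟨hs.1, hs.2.trans hσ.2⟩
  set y : ℝ → ℝ := fun σ => A + c * ∫ s in (0 : ℝ)..σ, n' s with hy
  have hder : ∀ σ, HasDerivAt (fun σ => y σ * Real.exp (-(c * σ)))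
      (c * n' σ * Real.exp (-(c * σ)) + y σ * (Real.exp (-(c * σ)) * -(c * 1))) σ := fun σ =>
    (((hcont.integral_hasStrictDerivAt 0 σ).hasDerivAt.const_mul c).const_add A).mul
      ((hasDerivAt_id σ).const_mul c).neg.exp
  have hanti : AntitoneOn (fun σ => y σ * Real.exp (-(c * σ))) (Icc 0 1) := by
    refine antitoneOn_of_deriv_nonpos (convex_Icc 0 1)
      (fun σ _ => (hder σ).continuousAt.continuousWithinAt)
      (fun σ _ => (hder σ).differentiableAt.differentiableWithinAt) fun σ hσ => ?_
    rw [interior_Icc] at hσ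
    have hσ' := Ioo_subset_Icc_self hσ
    rw [(hder σ).deriv]
    have h1 : n' σ ≤ y σ := by
      rw [heq σ hσ', hy]
      have := h σ hσ'
      rwa [hint σ hσ'] at this
    have h2 := mul_nonneg (mul_nonneg hc (Real.exp_pos (-(c * σ))).le) (sub_nonneg.2 h1)
    linarith
  intro σ hσ
  have h1 := hanti (left_mem_Icc.2 zero_le_one) hσ hσ.1
  have h2 : y σ * Real.exp (-(c * σ)) ≤ A := by simpa [hy] using h1
  have h3 : n σ ≤ y σ := by
    have := h σ hσ
    rwa [hint σ hσ] at this
  rw [Real.exp_neg, ← div_eq_mul_inv, div_le_iff₀ (Real.exp_pos _)] at h2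
  exact h3.trans h2

/-- The right-hand side of the equation rescaled to unit time; `L` is the length of the original time
interval. -/
noncomputable def forcing (F : L2 → L2) (L : ℝ) (a z : ℝ → L2) (s : ℝ) : L2 := L • F (z s) + a s

/-- A mild solution `z` on `[0,1]` of `z' = L (δ z_xx + F(z)) + a`, `z(0) = φ₀`, with bounds for the
time scale `L`, the initial value `φ₀` and the drive `a`. -/
structure IsScaledSolution (δ : ℝ) (F : L2 → L2) (l T R A L : ℝ) (φ₀ : L2) (a z : ℝ → L2) :
    Prop where
  le_scale : l ≤ L
  scale_le : L ≤ T
  norm_init_le : ‖φ₀‖ ≤ R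
  memLp : MemLp a 2 (volume.restrict (Ioc 0 1))
  energy_le : ∫ s in (0 : ℝ)..1, ‖a s‖ ^ 2 ≤ A
  continuousOn : ContinuousOn z (Icc 0 1)
  eq : ∀ σ ∈ Icc (0 : ℝ) 1, z σ = heatSemigroup δ (L * σ) φ₀
    + ∫ s in (0 : ℝ)..σ, heatSemigroup δ (L * (σ - s)) (forcing F L a z s)

section Scaled

variable {δ l T R A M L L₁ L₂ : ℝ} {F : L2 → L2} {φ₀ φ₁ φ₂ : L2} {a z z₁ z₂ : ℝ → L2}

theorem IsScaledSolution.integrableOn_norm_sq (h : IsScaledSolution δ F l T R A L φ₀ a z) :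
    IntegrableOn (fun s => ‖a s‖ ^ 2) (Ioc 0 1) :=
  h.memLp.integrable_norm_pow (by norm_num)

theorem intervalIntegrable_of_integrableOn {E : Type*} [NormedAddCommGroup E] {f : ℝ → E} {σ : ℝ}
    (hf : IntegrableOn f (Ioc 0 1)) (hσ : σ ∈ Icc (0 : ℝ) 1) : IntervalIntegrable f volume 0 σ := by
  rw [intervalIntegrable_iff_integrableOn_Ioc_of_le hσ.1]
  exact hf.mono_set (Ioc_subset_Ioc_right hσ.2)

theorem IsScaledSolution.integrableOn (h : IsScaledSolution δ F l T R A L φ₀ a z) :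
    IntegrableOn a (Ioc 0 1) :=
  h.memLp.integrable (by norm_num)

theorem IsScaledSolution.integrableOn_forcing (hF : IsRegularReaction F M)
    (h : IsScaledSolution δ F l T R A L φ₀ a z) : IntegrableOn (forcing F L a z) (Ioc 0 1) := by
  refine IntegrableOn.add ?_ h.integrableOn
  refine IntegrableOn.mono_set (t := Icc 0 1) ?_ Ioc_subset_Icc_self
  exact ((hF.continuous.comp_continuousOn h.continuousOn).const_smul L).integrableOn_Icc

theorem IsScaledSolution.intervalIntegrable (hδ : 0 < δ) (hl : 0 < l) (hF : IsRegularReaction F M)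
    (h : IsScaledSolution δ F l T R A L φ₀ a z) {σ : ℝ} (hσ : σ ∈ Icc (0 : ℝ) 1) :
    IntervalIntegrable (fun s => heatSemigroup δ (L * (σ - s)) (forcing F L a z s)) volume 0 σ :=
  intervalIntegrable_heatSemigroup hδ hσ.1 (by fun_prop)
    (fun _ hs => mul_nonneg (hl.le.trans h.le_scale) (sub_nonneg.2 hs.2))
    (intervalIntegrable_of_integrableOn (h.integrableOn_forcing hF) hσ)

theorem integral_le_integral_one {g : ℝ → ℝ} (hg : IntegrableOn g (Ioc 0 1)) (h0 : ∀ s, 0 ≤ g s)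
    {σ : ℝ} (hσ : σ ∈ Icc (0 : ℝ) 1) : ∫ s in (0 : ℝ)..σ, g s ≤ ∫ s in (0 : ℝ)..1, g s := by
  refine intervalIntegral.integral_mono_interval le_rfl hσ.1 hσ.2
    (Filter.Eventually.of_forall h0) ?_
  rwa [intervalIntegrable_iff_integrableOn_Ioc_of_le zero_le_one]

theorem IsScaledSolution.integral_norm_sq_le (h : IsScaledSolution δ F l T R A L φ₀ a z) {σ : ℝ}
    (hσ : σ ∈ Icc (0 : ℝ) 1) : ∫ s in (0 : ℝ)..σ, ‖a s‖ ^ 2 ≤ A :=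
  (integral_le_integral_one h.integrableOn_norm_sq (fun _ => sq_nonneg _) hσ).trans h.energy_le

theorem IsScaledSolution.integral_norm_le (h : IsScaledSolution δ F l T R A L φ₀ a z) {σ : ℝ}
    (hσ : σ ∈ Icc (0 : ℝ) 1) : ∫ s in (0 : ℝ)..σ, ‖a s‖ ≤ 1 + A := by
  have h1 : ∫ s in (0 : ℝ)..σ, ‖a s‖ ≤ ∫ s in (0 : ℝ)..σ, (1 + ‖a s‖ ^ 2) := by
    refine intervalIntegral.integral_mono_on hσ.1
      (intervalIntegrable_of_integrableOn h.integrableOn.norm hσ)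
      (intervalIntegrable_const.add
        (intervalIntegrable_of_integrableOn h.integrableOn_norm_sq hσ)) fun s _ => ?_
    nlinarith [sq_nonneg (‖a s‖ - 1)]
  rw [intervalIntegral.integral_add intervalIntegrable_const
    (intervalIntegrable_of_integrableOn h.integrableOn_norm_sq hσ),
    intervalIntegral.integral_const, smul_eq_mul] at h1
  linarith [h.integral_norm_sq_le hσ, hσ.2]

theorem IsScaledSolution.norm_forcing_le (hl : 0 < l) (hF : IsRegularReaction F M)
    (h : IsScaledSolution δ F l T R A L φ₀ a z) (s : ℝ) :
    ‖forcing F L a z s‖ ≤ T * M + ‖a s‖ := by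
  refine (norm_add_le _ _).trans (add_le_add ?_ le_rfl)
  rw [norm_smul, Real.norm_of_nonneg (hl.le.trans h.le_scale)]
  exact mul_le_mul h.scale_le (hF.bound _) (norm_nonneg _)
    (hl.le.trans (h.le_scale.trans h.scale_le))

theorem norm_forcing_sub_le (hl : 0 < l) (hF : IsRegularReaction F M)
    (h₂ : IsScaledSolution δ F l T R A L₂ φ₂ a z₂) (s : ℝ) :
    ‖forcing F L₁ a z₁ s - forcing F L₂ a z₂ s‖ ≤ M * |L₁ - L₂| + T * M * ‖z₁ s - z₂ s‖ := by
  have e : forcing F L₁ a z₁ s - forcing F L₂ a z₂ s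
      = (L₁ - L₂) • F (z₁ s) + L₂ • (F (z₁ s) - F (z₂ s)) := by
    unfold forcing; module
  rw [e]
  refine (norm_add_le _ _).trans (add_le_add ?_ ?_)
  · rw [norm_smul, mul_comm, Real.norm_eq_abs]
    exact mul_le_mul_of_nonneg_right (hF.bound _) (abs_nonneg _)
  · rw [norm_smul, Real.norm_of_nonneg (hl.le.trans h₂.le_scale), mul_assoc]
    exact mul_le_mul h₂.scale_le (hF.lipschitz _ _) (norm_nonneg _)
      (hl.le.trans (h₂.le_scale.trans h₂.scale_le))

theorem scaledSolution_sub_eq (hδ : 0 < δ) (hl : 0 < l) (hF : IsRegularReaction F M)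
    (h₁ : IsScaledSolution δ F l T R A L₁ φ₁ a z₁) (h₂ : IsScaledSolution δ F l T R A L₂ φ₂ a z₂)
    {σ : ℝ} (hσ : σ ∈ Icc (0 : ℝ) 1) :
    z₁ σ - z₂ σ = (heatSemigroup δ (L₁ * σ) φ₁ - heatSemigroup δ (L₂ * σ) φ₂)
      + ∫ s in (0 : ℝ)..σ, (heatSemigroup δ (L₁ * (σ - s)) (forcing F L₁ a z₁ s)
          - heatSemigroup δ (L₂ * (σ - s)) (forcing F L₂ a z₂ s)) := by
  rw [h₁.eq σ hσ, h₂.eq σ hσ, intervalIntegral.integral_sub (h₁.intervalIntegrable hδ hl hF hσ)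
    (h₂.intervalIntegrable hδ hl hF hσ)]
  abel

/-- Lipschitz dependence of the solution on the initial value and the time scale. -/
theorem exists_norm_scaledSolution_sub_le (hδ : 0 < δ) (hl : 0 < l) (hT : 0 ≤ T) (hR : 0 ≤ R)
    (hA : 0 ≤ A) (hF : IsRegularReaction F M) :
    ∃ C, 0 ≤ C ∧ ∀ {L₁ L₂ : ℝ} {φ₁ φ₂ : L2} {a z₁ z₂ : ℝ → L2},
      IsScaledSolution δ F l T R A L₁ φ₁ a z₁ → IsScaledSolution δ F l T R A L₂ φ₂ a z₂ →
      ∀ σ ∈ Icc (0 : ℝ) 1, ‖z₁ σ - z₂ σ‖ ≤ C * (‖φ₁ - φ₂‖ + |L₁ - L₂|) := by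
  have hM := hF.nonneg
  set c := 1 + 2 / l * R + M + 2 / l * (T * M + (1 + A)) with hc
  have hc0 : 0 ≤ c := by positivity
  refine ⟨c * Real.exp (T * M), by positivity, ?_⟩
  intro L₁ L₂ φ₁ φ₂ a z₁ z₂ h₁ h₂ σ hσ
  set D := ‖φ₁ - φ₂‖ + |L₁ - L₂| with hD
  have hD0 : 0 ≤ D := by positivity
  have hD1 : |L₁ - L₂| ≤ D := le_add_of_nonneg_left (norm_nonneg _)
  have hcont : ContinuousOn (fun s => ‖z₁ s - z₂ s‖) (Icc 0 1) :=
    (h₁.continuousOn.sub h₂.continuousOn).norm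
  have key : ∀ σ ∈ Icc (0 : ℝ) 1, ‖z₁ σ - z₂ σ‖
      ≤ c * D + T * M * ∫ s in (0 : ℝ)..σ, ‖z₁ s - z₂ s‖ := by
    intro σ hσ
    have hi₁ : IntervalIntegrable (fun s => ‖a s‖) volume 0 σ :=
      intervalIntegrable_of_integrableOn h₁.integrableOn.norm hσ
    have hi₂ : IntervalIntegrable (fun s => ‖z₁ s - z₂ s‖) volume 0 σ :=
      intervalIntegrable_of_integrableOn (hcont.integrableOn_Icc.mono_set Ioc_subset_Icc_self) hσ
    have hI : ‖∫ s in (0 : ℝ)..σ, (heatSemigroup δ (L₁ * (σ - s)) (forcing F L₁ a z₁ s)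
          - heatSemigroup δ (L₂ * (σ - s)) (forcing F L₂ a z₂ s))‖
        ≤ ∫ s in (0 : ℝ)..σ, ((M * |L₁ - L₂| + 2 / l * |L₁ - L₂| * (T * M)
            + 2 / l * |L₁ - L₂| * ‖a s‖) + T * M * ‖z₁ s - z₂ s‖) := by
      refine intervalIntegral.norm_integral_le_of_norm_le hσ.1
        (Filter.Eventually.of_forall fun s hs => ?_)
        ((intervalIntegrable_const.add (hi₁.const_mul _)).add (hi₂.const_mul _))
      refine (norm_heatSemigroup_apply_sub_le hδ hl h₁.le_scale h₂.le_scale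
        (sub_nonneg.2 hs.2) _ _).trans ?_
      have g₁ := norm_forcing_sub_le (L₁ := L₁) (z₁ := z₁) hl hF h₂ s
      have g₂ := mul_le_mul_of_nonneg_left (h₂.norm_forcing_le hl hF s)
        (by positivity : 0 ≤ 2 / l * |L₁ - L₂|)
      linarith
    rw [intervalIntegral.integral_add (intervalIntegrable_const.add (hi₁.const_mul _))
      (hi₂.const_mul _), intervalIntegral.integral_add intervalIntegrable_const (hi₁.const_mul _),
      intervalIntegral.integral_const, intervalIntegral.integral_const_mul,
      intervalIntegral.integral_const_mul, smul_eq_mul, sub_zero] at hI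
    rw [scaledSolution_sub_eq hδ hl hF h₁ h₂ hσ]
    refine (norm_add_le _ _).trans ?_
    have h0 := norm_heatSemigroup_apply_sub_le hδ hl h₁.le_scale h₂.le_scale hσ.1 φ₁ φ₂
    have e₁ : 2 / l * |L₁ - L₂| * ‖φ₂‖ ≤ 2 / l * R * D := by
      calc 2 / l * |L₁ - L₂| * ‖φ₂‖ ≤ 2 / l * D * R := by gcongr; exact h₂.norm_init_le
        _ = _ := by ring
    have e₂ : σ * (M * |L₁ - L₂| + 2 / l * |L₁ - L₂| * (T * M))
        ≤ M * D + 2 / l * (T * M) * D := by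
      calc _ ≤ 1 * (M * D + 2 / l * D * (T * M)) := by gcongr; exact hσ.2
        _ = _ := by ring
    have e₃ : 2 / l * |L₁ - L₂| * ∫ s in (0 : ℝ)..σ, ‖a s‖ ≤ 2 / l * (1 + A) * D := by
      calc _ ≤ 2 / l * D * (1 + A) :=
            mul_le_mul (by gcongr) (h₁.integral_norm_le hσ)
              (intervalIntegral.integral_nonneg hσ.1 fun _ _ => norm_nonneg _) (by positivity)
        _ = _ := by ring
    have e₄ : ‖φ₁ - φ₂‖ ≤ D := le_add_of_nonneg_right (abs_nonneg _)
    have e₅ : c * D = D + 2 / l * R * D + M * D + 2 / l * (T * M) * D + 2 / l * (1 + A) * D := by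
      rw [hc]; ring
    linarith
  refine (le_mul_exp_of_le_add_integral hcont (by positivity) key σ hσ).trans ?_
  calc c * D * Real.exp (T * M * σ) ≤ c * D * Real.exp (T * M) := by
        refine mul_le_mul_of_nonneg_left (Real.exp_le_exp.2 ?_) (by positivity)
        exact mul_le_of_le_one_right (by positivity) hσ.2
    _ = _ := by ring

end Scaled

/-! ### Essential bounds and second differences of solutions -/

section Scaled

variable {δ l T R A M L L₁ L₂ : ℝ} {F : L2 → L2} {φ₀ φ₁ φ₂ : L2} {a z z₁ z₂ : ℝ → L2}

theorem intervalIntegrable_rpow_sub (σ : ℝ) :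
    IntervalIntegrable (fun s : ℝ => (σ - s) ^ (-(3 / 4) : ℝ)) volume 0 σ := by
  have h := (intervalIntegral.intervalIntegrable_rpow' (a := σ) (b := 0)
    (r := (-(3 / 4) : ℝ)) (by norm_num)).comp_sub_left σ
  simpa using h

theorem integral_rpow_neg_three_fourths {σ : ℝ} :
    ∫ s in (0 : ℝ)..σ, s ^ (-(3 / 4) : ℝ) = 4 * σ ^ (1 / 4 : ℝ) := by
  rw [integral_rpow (Or.inl (by norm_num))]
  norm_num
  ring

theorem integral_rpow_le {σ : ℝ} (hσ : σ ∈ Icc (0 : ℝ) 1) :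
    ∫ s in (0 : ℝ)..σ, s ^ (-(3 / 4) : ℝ) ≤ 4 := by
  rw [integral_rpow_neg_three_fourths]
  linarith [Real.rpow_le_one hσ.1 hσ.2 (by norm_num : (0 : ℝ) ≤ 1 / 4)]

theorem integral_rpow_sub_le {σ : ℝ} (hσ : σ ∈ Icc (0 : ℝ) 1) :
    ∫ s in (0 : ℝ)..σ, (σ - s) ^ (-(3 / 4) : ℝ) ≤ 4 := by
  rw [intervalIntegral.integral_comp_sub_left (fun s => s ^ (-(3 / 4) : ℝ)) σ, sub_self, sub_zero]
  exact integral_rpow_le hσ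

theorem rpow_neg_three_eighths_sq {τ : ℝ} (hτ : 0 < τ) :
    (τ ^ (-(3 / 8) : ℝ)) ^ 2 = τ ^ (-(3 / 4) : ℝ) := by
  rw [← Real.rpow_natCast, ← Real.rpow_mul hτ.le]
  norm_num

/-- At positive times, the difference of two solutions is bounded, with a bound whose square is
integrable in time. The two kernels `(σ - s)^{-3/8}` and `‖a(s)‖` under the Duhamel integral are
both square integrable. -/
theorem exists_supLE_scaledSolution_sub (hδ : 0 < δ) (hl : 0 < l) (hT : 0 ≤ T) (hR : 0 ≤ R)
    (hA : 0 ≤ A) (hF : IsRegularReaction F M) :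
    ∃ C, 0 ≤ C ∧ ∀ {L₁ L₂ : ℝ} {φ₁ φ₂ : L2} {a z₁ z₂ : ℝ → L2},
      IsScaledSolution δ F l T R A L₁ φ₁ a z₁ → IsScaledSolution δ F l T R A L₂ φ₂ a z₂ →
      ∀ σ ∈ Ioc (0 : ℝ) 1, SupLE (z₁ σ - z₂ σ)
        (C * (‖φ₁ - φ₂‖ + |L₁ - L₂|) * (σ ^ (-(3 / 8) : ℝ) + 1)) := by
  have hM := hF.nonneg
  obtain ⟨κ, hκ, hsup⟩ := exists_supLE_heatSemigroup_apply_sub hδ hl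
  obtain ⟨C₁, hC₁, hlip⟩ := exists_norm_scaledSolution_sub_le hδ hl hT hR hA hF
  set c := M + T * M * C₁ + 2 / l * (T * M) with hc
  have hc0 : 0 ≤ c := by positivity
  refine ⟨κ * ((1 + 2 / l * R) + (4 + c ^ 2 + (2 / l) ^ 2 * A)), by positivity, ?_⟩
  intro L₁ L₂ φ₁ φ₂ a z₁ z₂ h₁ h₂ σ hσ
  have hσ' := Ioc_subset_Icc_self hσ
  set D := ‖φ₁ - φ₂‖ + |L₁ - L₂| with hD
  have hD0 : 0 ≤ D := by positivity
  have hD1 : |L₁ - L₂| ≤ D := le_add_of_nonneg_left (norm_nonneg _)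
  have hi : IntervalIntegrable (fun s => ‖a s‖ ^ 2) volume 0 σ :=
    intervalIntegrable_of_integrableOn h₁.integrableOn_norm_sq hσ'
  have hinit : SupLE (heatSemigroup δ (L₁ * σ) φ₁ - heatSemigroup δ (L₂ * σ) φ₂)
      (κ * σ ^ (-(3 / 8) : ℝ) * ((1 + 2 / l * R) * D)) := by
    refine (hsup L₁ L₂ σ φ₁ φ₂ h₁.le_scale h₂.le_scale hσ.1).mono
      (mul_le_mul_of_nonneg_left ?_ (mul_nonneg hκ (Real.rpow_nonneg hσ.1.le _)))
    have e₁ : 2 / l * |L₁ - L₂| * ‖φ₂‖ ≤ 2 / l * D * R := by gcongr; exact h₂.norm_init_le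
    have e₂ : ‖φ₁ - φ₂‖ ≤ D := le_add_of_nonneg_right (abs_nonneg _)
    linarith
  have hiκ : IntervalIntegrable (fun s => κ * D *
      (((σ - s) ^ (-(3 / 4) : ℝ) + c ^ 2) + (2 / l) ^ 2 * ‖a s‖ ^ 2)) volume 0 σ :=
    (((intervalIntegrable_rpow_sub σ).add intervalIntegrable_const).add
      (hi.const_mul _)).const_mul _
  have hduh : SupLE (∫ s in (0 : ℝ)..σ, (heatSemigroup δ (L₁ * (σ - s)) (forcing F L₁ a z₁ s)
        - heatSemigroup δ (L₂ * (σ - s)) (forcing F L₂ a z₂ s)))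
      (∫ s in (0 : ℝ)..σ, κ * D *
        (((σ - s) ^ (-(3 / 4) : ℝ) + c ^ 2) + (2 / l) ^ 2 * ‖a s‖ ^ 2)) := by
    refine SupLE.intervalIntegral hσ.1.le ((h₁.intervalIntegrable hδ hl hF hσ').sub
      (h₂.intervalIntegrable hδ hl hF hσ')) hiκ fun s hs => ?_
    have hτ : 0 < σ - s := sub_pos.2 hs.2
    refine (hsup L₁ L₂ (σ - s) _ _ h₁.le_scale h₂.le_scale hτ).mono ?_
    have g₁ := norm_forcing_sub_le (L₁ := L₁) (z₁ := z₁) hl hF h₂ s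
    have g₂ := mul_le_mul_of_nonneg_left (h₂.norm_forcing_le hl hF s)
      (by positivity : 0 ≤ 2 / l * |L₁ - L₂|)
    have g₃ := mul_le_mul_of_nonneg_left (hlip h₁ h₂ s ⟨hs.1.le, hs.2.le.trans hσ.2⟩)
      (by positivity : 0 ≤ T * M)
    have g₄ : M * |L₁ - L₂| + 2 / l * |L₁ - L₂| * (T * M + ‖a s‖)
        ≤ M * D + 2 / l * D * (T * M + ‖a s‖) := by gcongr
    have g₅ : ‖forcing F L₁ a z₁ s - forcing F L₂ a z₂ s‖
        + 2 / l * |L₁ - L₂| * ‖forcing F L₂ a z₂ s‖ ≤ D * (c + 2 / l * ‖a s‖) := by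
      rw [hc]; linarith
    have hk0 : 0 ≤ (σ - s) ^ (-(3 / 8) : ℝ) := Real.rpow_nonneg hτ.le _
    calc _ ≤ κ * (σ - s) ^ (-(3 / 8) : ℝ) * (D * (c + 2 / l * ‖a s‖)) :=
          mul_le_mul_of_nonneg_left g₅ (by positivity)
      _ = κ * D * ((σ - s) ^ (-(3 / 8) : ℝ) * (c + 2 / l * ‖a s‖)) := by ring
      _ ≤ _ := by
          refine mul_le_mul_of_nonneg_left ?_ (by positivity)
          rw [← rpow_neg_three_eighths_sq hτ]
          nlinarith [sq_nonneg ((σ - s) ^ (-(3 / 8) : ℝ) - (c + 2 / l * ‖a s‖)),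
            sq_nonneg (c - 2 / l * ‖a s‖), sq_nonneg ((σ - s) ^ (-(3 / 8) : ℝ))]
  have hval : ∫ s in (0 : ℝ)..σ, κ * D *
        (((σ - s) ^ (-(3 / 4) : ℝ) + c ^ 2) + (2 / l) ^ 2 * ‖a s‖ ^ 2)
      ≤ κ * D * (4 + c ^ 2 + (2 / l) ^ 2 * A) := by
    rw [intervalIntegral.integral_const_mul, intervalIntegral.integral_add
      ((intervalIntegrable_rpow_sub σ).add intervalIntegrable_const) (hi.const_mul _),
      intervalIntegral.integral_add (intervalIntegrable_rpow_sub σ) intervalIntegrable_const,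
      intervalIntegral.integral_const_mul, intervalIntegral.integral_const, smul_eq_mul, sub_zero]
    have g₁ := integral_rpow_sub_le hσ'
    have g₂ := h₁.integral_norm_sq_le hσ'
    have g₃ : σ * c ^ 2 ≤ c ^ 2 := mul_le_of_le_one_left (sq_nonneg c) hσ.2
    gcongr
  rw [scaledSolution_sub_eq hδ hl hF h₁ h₂ hσ']
  refine (hinit.add (hduh.mono hval)).mono ?_
  have hk0 : 0 ≤ σ ^ (-(3 / 8) : ℝ) := Real.rpow_nonneg hσ.1.le _
  set k := σ ^ (-(3 / 8) : ℝ)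
  have p₁ : 0 ≤ κ * D * (1 + 2 / l * R) := by positivity
  have p₂ : 0 ≤ κ * D * (4 + c ^ 2 + (2 / l) ^ 2 * A) * k := by positivity
  linarith

/-- The second difference of the nonlinear terms, in terms of that of the solutions. The product rule
for second differences produces the mixed term in `|L₁ - L₂|`. -/
theorem norm_forcing_second_difference_le (hF : IsRegularReaction F M) {r : ℝ}
    (hr : r ∈ Icc (0 : ℝ) 1) (hL : 0 ≤ r * L₁ + (1 - r) * L₂) (hLT : r * L₁ + (1 - r) * L₂ ≤ T)
    {s ρ w : ℝ} (hw : ‖z₁ s - z₂ s‖ ≤ w) (hρ : SupLE (z₁ s - z₂ s) ρ) :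
    ‖r • forcing F L₁ a z₁ s + (1 - r) • forcing F L₂ a z₂ s
        - forcing F (r * L₁ + (1 - r) * L₂) a z s‖
      ≤ r * (1 - r) * (|L₁ - L₂| * (M * w) + T * M * ρ ^ 2)
        + T * M * ‖r • z₁ s + (1 - r) • z₂ s - z s‖ := by
  have hM := hF.nonneg
  have hr' : 0 ≤ r * (1 - r) := mul_nonneg hr.1 (by linarith [hr.2])
  set L := r * L₁ + (1 - r) * L₂ with hLdef
  set zr := r • z₁ s + (1 - r) • z₂ s with hzr
  have e : r • forcing F L₁ a z₁ s + (1 - r) • forcing F L₂ a z₂ s - forcing F L a z s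
      = (r * (1 - r)) • ((L₁ - L₂) • (F (z₁ s) - F (z₂ s)))
        + L • (r • F (z₁ s) + (1 - r) • F (z₂ s) - F zr) + L • (F zr - F (z s)) := by
    simp only [forcing, hLdef]; module
  rw [e]
  have b₁ : ‖(r * (1 - r)) • ((L₁ - L₂) • (F (z₁ s) - F (z₂ s)))‖
      ≤ r * (1 - r) * (|L₁ - L₂| * (M * w)) := by
    rw [norm_smul, norm_smul, Real.norm_of_nonneg hr', Real.norm_eq_abs]
    refine mul_le_mul_of_nonneg_left (mul_le_mul_of_nonneg_left ?_ (abs_nonneg _)) hr'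
    exact (hF.lipschitz _ _).trans (mul_le_mul_of_nonneg_left hw hM)
  have b₂ : ‖L • (r • F (z₁ s) + (1 - r) • F (z₂ s) - F zr)‖
      ≤ T * (M * (r * (1 - r)) * ρ ^ 2) := by
    rw [norm_smul, Real.norm_of_nonneg hL]
    exact mul_le_mul hLT (hF.second _ _ _ _ hr hρ) (norm_nonneg _) (hL.trans hLT)
  have b₃ : ‖L • (F zr - F (z s))‖ ≤ T * (M * ‖zr - z s‖) := by
    rw [norm_smul, Real.norm_of_nonneg hL]
    exact mul_le_mul hLT (hF.lipschitz _ _) (norm_nonneg _) (hL.trans hLT)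
  refine (norm_add₃_le).trans ?_
  linarith

/-- The second difference of the integrand of the Duhamel integral. -/
theorem norm_duhamel_second_difference_le (hδ : 0 < δ) (hl : 0 < l) (hF : IsRegularReaction F M)
    (hT : 0 ≤ T) {C₁ C₂ D r s τ : ℝ} (hC₁ : 0 ≤ C₁) (hr : r ∈ Icc (0 : ℝ) 1)
    (h₁ : IsScaledSolution δ F l T R A L₁ φ₁ a z₁) (h₂ : IsScaledSolution δ F l T R A L₂ φ₂ a z₂)
    (h : IsScaledSolution δ F l T R A (r * L₁ + (1 - r) * L₂) φ₀ a z)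
    (hD0 : 0 ≤ D) (hD1 : |L₁ - L₂| ≤ D) (hs : 0 < s) (hτ : 0 ≤ τ)
    (hw : ‖z₁ s - z₂ s‖ ≤ C₁ * D)
    (hρ : SupLE (z₁ s - z₂ s) (C₂ * D * (s ^ (-(3 / 8) : ℝ) + 1))) :
    ‖r • heatSemigroup δ (L₁ * τ) (forcing F L₁ a z₁ s)
        + (1 - r) • heatSemigroup δ (L₂ * τ) (forcing F L₂ a z₂ s)
        - heatSemigroup δ ((r * L₁ + (1 - r) * L₂) * τ)
            (forcing F (r * L₁ + (1 - r) * L₂) a z s)‖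
      ≤ r * (1 - r) * D ^ 2 * (((2 / l) ^ 2 * (T * M) + 2 / l * (M + T * M * C₁) + M * C₁
            + T * M * C₂ ^ 2 * 2 + (2 / l) ^ 2 * ‖a s‖) + T * M * C₂ ^ 2 * 2 * s ^ (-(3 / 4) : ℝ))
        + T * M * ‖r • z₁ s + (1 - r) • z₂ s - z s‖ := by
  have hM := hF.nonneg
  have hr1 : 0 ≤ 1 - r := by linarith [hr.2]
  have hr' : 0 ≤ r * (1 - r) := mul_nonneg hr.1 hr1
  have hfd : ‖forcing F L₁ a z₁ s - forcing F L₂ a z₂ s‖ ≤ (M + T * M * C₁) * D := by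
    refine (norm_forcing_sub_le hl hF h₂ s).trans ?_
    have g₁ := mul_le_mul_of_nonneg_left hD1 hM
    have g₂ := mul_le_mul_of_nonneg_left hw (mul_nonneg hT hM)
    linarith
  have hfr : ‖r • forcing F L₁ a z₁ s + (1 - r) • forcing F L₂ a z₂ s‖ ≤ T * M + ‖a s‖ := by
    refine (norm_add_le _ _).trans ?_
    rw [norm_smul, norm_smul, Real.norm_of_nonneg hr.1, Real.norm_of_nonneg hr1]
    have g₁ := mul_le_mul_of_nonneg_left (h₁.norm_forcing_le hl hF s) hr.1
    have g₂ := mul_le_mul_of_nonneg_left (h₂.norm_forcing_le hl hF s) hr1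
    linarith
  have hL0 : 0 ≤ r * L₁ + (1 - r) * L₂ := hl.le.trans h.le_scale
  have hn := norm_forcing_second_difference_le (a := a) (z := z) hF hr hL0 h.scale_le hw hρ
  have hb := norm_second_difference_heatSemigroup_apply_le hδ hl h₁.le_scale h₂.le_scale hτ hr
    (forcing F L₁ a z₁ s) (forcing F L₂ a z₂ s)
  have hLT := h.scale_le
  generalize forcing F L₁ a z₁ s = f₁ at *
  generalize forcing F L₂ a z₂ s = f₂ at *
  generalize forcing F (r * L₁ + (1 - r) * L₂) a z s = f at *
  set L := r * L₁ + (1 - r) * L₂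
  have hLτ : 0 ≤ L * τ := mul_nonneg hL0 hτ
  have e' : r • heatSemigroup δ (L₁ * τ) f₁
        + (1 - r) • heatSemigroup δ (L₂ * τ) f₂ - heatSemigroup δ (L * τ) f
      = (r • heatSemigroup δ (L₁ * τ) f₁ + (1 - r) • heatSemigroup δ (L₂ * τ) f₂
          - heatSemigroup δ (L * τ) (r • f₁ + (1 - r) • f₂))
        + heatSemigroup δ (L * τ) (r • f₁ + (1 - r) • f₂ - f) := by
    rw [heatSemigroup_sub hδ hLτ]; abel
  have hb' : (2 / l) ^ 2 * |L₁ - L₂| ^ 2 * ‖r • f₁ + (1 - r) • f₂‖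
      + 2 / l * |L₁ - L₂| * ‖f₁ - f₂‖
      ≤ (2 / l) ^ 2 * D ^ 2 * (T * M + ‖a s‖) + 2 / l * D * ((M + T * M * C₁) * D) := by
    gcongr
  have hρ' : (C₂ * D * (s ^ (-(3 / 8) : ℝ) + 1)) ^ 2
      ≤ C₂ ^ 2 * D ^ 2 * (2 * s ^ (-(3 / 4) : ℝ) + 2) := by
    rw [mul_pow, mul_pow, ← rpow_neg_three_eighths_sq hs]
    refine mul_le_mul_of_nonneg_left ?_ (by positivity)
    linarith [sq_nonneg (s ^ (-(3 / 8) : ℝ) - 1)]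
  have hn' : |L₁ - L₂| * (M * (C₁ * D)) + T * M * (C₂ * D * (s ^ (-(3 / 8) : ℝ) + 1)) ^ 2
      ≤ D * (M * (C₁ * D)) + T * M * (C₂ ^ 2 * D ^ 2 * (2 * s ^ (-(3 / 4) : ℝ) + 2)) := by
    gcongr
  rw [e']
  refine (norm_add_le _ _).trans ((add_le_add (hb.trans (mul_le_mul_of_nonneg_left hb' hr'))
    ((norm_heatSemigroup_le hδ hLτ _).trans
      (hn.trans (add_le_add (mul_le_mul_of_nonneg_left hn' hr') le_rfl)))).trans (le_of_eq ?_))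
  ring

/-- The solution map `(φ₀, L) ↦ z` has bounded second differences in `L²(0,1)`, at all times. -/
theorem exists_norm_scaledSolution_second_difference_le (hδ : 0 < δ) (hl : 0 < l) (hT : 0 ≤ T)
    (hR : 0 ≤ R) (hA : 0 ≤ A) (hF : IsRegularReaction F M) :
    ∃ C, 0 ≤ C ∧ ∀ {L₁ L₂ r : ℝ} {φ₁ φ₂ : L2} {a z z₁ z₂ : ℝ → L2}, r ∈ Icc (0 : ℝ) 1 →
      IsScaledSolution δ F l T R A L₁ φ₁ a z₁ → IsScaledSolution δ F l T R A L₂ φ₂ a z₂ →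
      IsScaledSolution δ F l T R A (r * L₁ + (1 - r) * L₂) (r • φ₁ + (1 - r) • φ₂) a z →
      ∀ σ ∈ Icc (0 : ℝ) 1, ‖r • z₁ σ + (1 - r) • z₂ σ - z σ‖
        ≤ C * (r * (1 - r)) * (‖φ₁ - φ₂‖ + |L₁ - L₂|) ^ 2 := by
  have hM := hF.nonneg
  obtain ⟨C₁, hC₁, hlip⟩ := exists_norm_scaledSolution_sub_le hδ hl hT hR hA hF
  obtain ⟨C₂, hC₂, hsup⟩ := exists_supLE_scaledSolution_sub hδ hl hT hR hA hF
  -- the coefficients of `1`, `‖a s‖` and `s ^ (-3/4)` in the bound of the Duhamel integrand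
  set k₀ := (2 / l) ^ 2 * (T * M) + 2 / l * (M + T * M * C₁) + M * C₁ + T * M * C₂ ^ 2 * 2 with hk₀
  set k₁ := (2 / l) ^ 2 with hk₁
  set k₂ := T * M * C₂ ^ 2 * 2 with hk₂
  have hk₀0 : 0 ≤ k₀ := by positivity
  have hk₁0 : 0 ≤ k₁ := by positivity
  have hk₂0 : 0 ≤ k₂ := by positivity
  set c := (2 / l) ^ 2 * R + 2 / l + (k₀ + k₁ * (1 + A) + k₂ * 4) with hc
  have hc0 : 0 ≤ c := by positivity
  refine ⟨c * Real.exp (T * M), by positivity, ?_⟩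
  intro L₁ L₂ r φ₁ φ₂ a z z₁ z₂ hr h₁ h₂ h
  set D := ‖φ₁ - φ₂‖ + |L₁ - L₂| with hD
  have hD0 : 0 ≤ D := by positivity
  have hD1 : |L₁ - L₂| ≤ D := le_add_of_nonneg_left (norm_nonneg _)
  have hD2 : ‖φ₁ - φ₂‖ ≤ D := le_add_of_nonneg_right (abs_nonneg _)
  have hr1 : 0 ≤ 1 - r := by linarith [hr.2]
  have hr' : 0 ≤ r * (1 - r) := mul_nonneg hr.1 hr1
  set L := r * L₁ + (1 - r) * L₂ with hLdef
  have hL0 : 0 ≤ L := hl.le.trans h.le_scale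
  have hcont : ContinuousOn (fun s => ‖r • z₁ s + (1 - r) • z₂ s - z s‖) (Icc 0 1) :=
    (((h₁.continuousOn.const_smul r).add (h₂.continuousOn.const_smul (1 - r))).sub
      h.continuousOn).norm
  have key : ∀ σ ∈ Icc (0 : ℝ) 1, ‖r • z₁ σ + (1 - r) • z₂ σ - z σ‖
      ≤ c * (r * (1 - r)) * D ^ 2
        + T * M * ∫ s in (0 : ℝ)..σ, ‖r • z₁ s + (1 - r) • z₂ s - z s‖ := by
    intro σ hσ
    have i₁ := h₁.intervalIntegrable hδ hl hF hσ
    have i₂ := h₂.intervalIntegrable hδ hl hF hσ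
    have i₃ := h.intervalIntegrable hδ hl hF hσ
    have hi₁ : IntervalIntegrable (fun s => ‖a s‖) volume 0 σ :=
      intervalIntegrable_of_integrableOn h.integrableOn.norm hσ
    have hi₂ : IntervalIntegrable (fun s => ‖r • z₁ s + (1 - r) • z₂ s - z s‖) volume 0 σ :=
      intervalIntegrable_of_integrableOn (hcont.integrableOn_Icc.mono_set Ioc_subset_Icc_self) hσ
    have hi₃ : IntervalIntegrable (fun s : ℝ => s ^ (-(3 / 4) : ℝ)) volume 0 σ :=
      intervalIntegral.intervalIntegrable_rpow' (by norm_num)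
    have hi₄ : IntervalIntegrable (fun s => r * (1 - r) * D ^ 2
        * ((k₀ + k₁ * ‖a s‖) + k₂ * s ^ (-(3 / 4) : ℝ))) volume 0 σ :=
      ((intervalIntegrable_const.add (hi₁.const_mul _)).add (hi₃.const_mul _)).const_mul _
    have e : r • z₁ σ + (1 - r) • z₂ σ - z σ
        = (r • heatSemigroup δ (L₁ * σ) φ₁ + (1 - r) • heatSemigroup δ (L₂ * σ) φ₂
            - heatSemigroup δ (L * σ) (r • φ₁ + (1 - r) • φ₂))
          + ∫ s in (0 : ℝ)..σ, (r • heatSemigroup δ (L₁ * (σ - s)) (forcing F L₁ a z₁ s)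
            + (1 - r) • heatSemigroup δ (L₂ * (σ - s)) (forcing F L₂ a z₂ s)
            - heatSemigroup δ (L * (σ - s)) (forcing F L a z s)) := by
      have j₁ : IntervalIntegrable (fun s => r • heatSemigroup δ (L₁ * (σ - s))
        (forcing F L₁ a z₁ s)) volume 0 σ := i₁.smul r
      have j₂ : IntervalIntegrable (fun s => (1 - r) • heatSemigroup δ (L₂ * (σ - s))
        (forcing F L₂ a z₂ s)) volume 0 σ := i₂.smul (1 - r)
      rw [intervalIntegral.integral_sub (j₁.add j₂) i₃, intervalIntegral.integral_add j₁ j₂,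
        intervalIntegral.integral_smul, intervalIntegral.integral_smul,
        h₁.eq σ hσ, h₂.eq σ hσ, h.eq σ hσ]
      module
    have hI : ‖∫ s in (0 : ℝ)..σ, (r • heatSemigroup δ (L₁ * (σ - s)) (forcing F L₁ a z₁ s)
            + (1 - r) • heatSemigroup δ (L₂ * (σ - s)) (forcing F L₂ a z₂ s)
            - heatSemigroup δ (L * (σ - s)) (forcing F L a z s))‖
        ≤ ∫ s in (0 : ℝ)..σ, (r * (1 - r) * D ^ 2
            * ((k₀ + k₁ * ‖a s‖) + k₂ * s ^ (-(3 / 4) : ℝ))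
            + T * M * ‖r • z₁ s + (1 - r) • z₂ s - z s‖) := by
      refine intervalIntegral.norm_integral_le_of_norm_le hσ.1
        (Filter.Eventually.of_forall fun s hs => ?_) (hi₄.add (hi₂.const_mul _))
      have hs1 : s ∈ Ioc (0 : ℝ) 1 := ⟨hs.1, hs.2.trans hσ.2⟩
      refine (norm_duhamel_second_difference_le hδ hl hF hT hC₁ hr h₁ h₂ h hD0 hD1 hs.1
        (sub_nonneg.2 hs.2) (hlip h₁ h₂ s (Ioc_subset_Icc_self hs1)) (hsup h₁ h₂ s hs1)).trans
        (le_of_eq ?_)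
      rw [hk₀, hk₁, hk₂]
    rw [intervalIntegral.integral_add hi₄ (hi₂.const_mul _), intervalIntegral.integral_const_mul,
      intervalIntegral.integral_add (intervalIntegrable_const.add (hi₁.const_mul _))
      (hi₃.const_mul _), intervalIntegral.integral_add intervalIntegrable_const (hi₁.const_mul _),
      intervalIntegral.integral_const, intervalIntegral.integral_const_mul,
      intervalIntegral.integral_const_mul, intervalIntegral.integral_const_mul, smul_eq_mul,
      sub_zero] at hI
    have hJ : σ * k₀ + k₁ * (∫ s in (0 : ℝ)..σ, ‖a s‖)
        + k₂ * (∫ s in (0 : ℝ)..σ, s ^ (-(3 / 4) : ℝ)) ≤ k₀ + k₁ * (1 + A) + k₂ * 4 := by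
      have g₁ := h.integral_norm_le hσ
      have g₂ := integral_rpow_le hσ
      have g₃ : σ * k₀ ≤ k₀ := mul_le_of_le_one_left hk₀0 hσ.2
      gcongr
    have h0 := norm_second_difference_heatSemigroup_apply_le hδ hl h₁.le_scale h₂.le_scale hσ.1 hr
      φ₁ φ₂
    have h0' : (2 / l) ^ 2 * |L₁ - L₂| ^ 2 * ‖r • φ₁ + (1 - r) • φ₂‖
        + 2 / l * |L₁ - L₂| * ‖φ₁ - φ₂‖ ≤ (2 / l) ^ 2 * D ^ 2 * R + 2 / l * D * D := by
      gcongr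
      exact h.norm_init_le
    rw [e]
    refine (norm_add_le _ _).trans ((add_le_add (h0.trans (mul_le_mul_of_nonneg_left h0' hr'))
      (hI.trans (add_le_add (mul_le_mul_of_nonneg_left hJ (by positivity)) le_rfl))).trans
        (le_of_eq ?_))
    rw [hc]
    ring
  intro σ hσ
  refine (le_mul_exp_of_le_add_integral hcont (by positivity) key σ hσ).trans ?_
  calc c * (r * (1 - r)) * D ^ 2 * Real.exp (T * M * σ)
      ≤ c * (r * (1 - r)) * D ^ 2 * Real.exp (T * M) := by
        refine mul_le_mul_of_nonneg_left (Real.exp_le_exp.2 ?_) (by positivity)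
        exact mul_le_of_le_one_right (by positivity) hσ.2
    _ = _ := by ring

end Scaled

/-! ### Rescaling a control problem to the unit time interval -/

theorem memLp_comp_affine {E : Type*} [NormedAddCommGroup E] {α : ℝ → E} {p q u v : ℝ} (hq : 0 < q)
    (h : MemLp α 2 (volume.restrict (Ioo (p + q * u) (p + q * v)))) :
    MemLp (fun s => α (p + q * s)) 2 (volume.restrict (Ioo u v)) := by
  have hmap : Measure.map (fun s : ℝ => p + q * s) volume = ENNReal.ofReal |q⁻¹| • volume := by
    rw [show (fun s : ℝ => p + q * s) = (fun s => p + s) ∘ fun s => q * s from rfl,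
      ← Measure.map_map (g := fun s : ℝ => p + s) (f := fun s : ℝ => q * s) (by fun_prop)
      (by fun_prop), Real.map_volume_mul_left hq.ne', Measure.map_smul, map_add_left_eq_self]
  have h1 := (memLp_indicator_iff_restrict measurableSet_Ioo).2 h
  have h2 := (h1.smul_measure (c := ENNReal.ofReal |q⁻¹|) ENNReal.ofReal_ne_top)
  rw [← hmap] at h2
  have h3 := h2.comp_of_map (by fun_prop)
  refine (memLp_indicator_iff_restrict measurableSet_Ioo).1 ?_
  convert h3 using 1
  ext s
  have hs : s ∈ Ioo u v ↔ p + q * s ∈ Ioo (p + q * u) (p + q * v) := by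
    simp only [mem_Ioo, add_lt_add_iff_left, mul_lt_mul_iff_right₀ hq]
  simp only [Function.comp_apply, indicator_apply, hs]

section Rescaling

variable {δ K T t₀ l R A M : ℝ} {V : ℝ → ℝ} {φm φ₀ : L2} {α φ : ℝ → L2}

/-- The drive of the rescaled equation. -/
noncomputable def rescale (T t₀ : ℝ) (α : ℝ → L2) (s : ℝ) : L2 :=
  (T - t₀) • α (t₀ + (T - t₀) * s)

theorem integral_norm_sq_rescale (ht : t₀ < T) (α : ℝ → L2) :
    ∫ t in t₀..T, ‖α t‖ ^ 2 / 2 = (∫ s in (0 : ℝ)..1, ‖rescale T t₀ α s‖ ^ 2) / (2 * (T - t₀)) := by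
  have hL : 0 < T - t₀ := sub_pos.2 ht
  have h := intervalIntegral.integral_comp_add_mul (a := 0) (b := 1) (fun t => ‖α t‖ ^ 2 / 2)
    hL.ne' t₀
  rw [mul_zero, add_zero, mul_one, add_sub_cancel, smul_eq_mul] at h
  have h2 : ∫ s in (0 : ℝ)..1, ‖rescale T t₀ α s‖ ^ 2
      = 2 * (T - t₀) ^ 2 * ∫ s in (0 : ℝ)..1, ‖α (t₀ + (T - t₀) * s)‖ ^ 2 / 2 := by
    rw [← intervalIntegral.integral_const_mul]
    refine intervalIntegral.integral_congr fun s _ => ?_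
    simp only [rescale, norm_smul, Real.norm_of_nonneg hL.le]
    ring
  rw [h2, h]
  field_simp

theorem isScaledSolution_of_isMildSolution (ht : t₀ < T) (hl : l ≤ T - t₀) (h0 : 0 ≤ t₀)
    (hR : ‖φ₀‖ ≤ R) (hα : MemLp α 2 (volume.restrict (Ioo t₀ T)))
    (hA : ∫ s in (0 : ℝ)..1, ‖rescale T t₀ α s‖ ^ 2 ≤ A) (h : IsMildSolution δ T V φ₀ t₀ α φ) :
    IsScaledSolution δ (reaction δ V) l T R A (T - t₀) φ₀ (rescale T t₀ α)
      (fun s => φ (t₀ + (T - t₀) * s)) where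
  le_scale := hl
  scale_le := by linarith
  norm_init_le := hR
  memLp := by
    rw [← restrict_Ioo_eq_restrict_Ioc]
    refine (memLp_comp_affine (p := t₀) (q := T - t₀) (sub_pos.2 ht) ?_).const_smul (T - t₀)
    rwa [mul_zero, add_zero, mul_one, add_sub_cancel]
  energy_le := hA
  continuousOn := by
    refine h.1.comp (by fun_prop) fun s hs => ?_
    have hL : 0 < T - t₀ := sub_pos.2 ht
    constructor <;> nlinarith [hs.1, hs.2]
  eq := by
    intro σ hσ
    have hL : 0 < T - t₀ := sub_pos.2 ht
    have hmem : t₀ + (T - t₀) * σ ∈ Icc t₀ T := by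
      constructor <;> nlinarith [hσ.1, hσ.2]
    rw [h.2 _ hmem, add_sub_cancel_left]
    congr 1
    have hsub := intervalIntegral.integral_comp_add_mul (a := 0) (b := σ)
      (fun s => heatSemigroup δ (t₀ + (T - t₀) * σ - s)
        (-(δ⁻¹ • superposition (deriv V) (φ s)) + α s)) hL.ne' t₀
    rw [mul_zero, add_zero] at hsub
    rw [(inv_smul_eq_iff₀ hL.ne').1 hsub.symm, ← intervalIntegral.integral_smul]
    refine intervalIntegral.integral_congr fun s _ => ?_
    rw [← heatSemigroup_smul, smul_add,
      show t₀ + (T - t₀) * σ - (t₀ + (T - t₀) * s) = (T - t₀) * (σ - s) by ring]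
    rfl

theorem cost_eq_rescale (ht : t₀ < T) :
    cost K T φm t₀ α φ = (∫ s in (0 : ℝ)..1, ‖rescale T t₀ α s‖ ^ 2) / (2 * (T - t₀))
      + K * ‖φ (t₀ + (T - t₀) * 1) - φm‖ ^ 2 := by
  rw [cost, integral_norm_sq_rescale ht, mul_one, add_sub_cancel]

/-- A control with initial time `t₀` can be replaced by a control with initial time `t₁` such that the
drives of the rescaled equations agree. -/
theorem exists_rescale_eq {t₁ : ℝ} (h₀ : t₀ < T) (h₁ : t₁ < T)
    (hα : MemLp α 2 (volume.restrict (Ioo t₀ T))) :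
    ∃ β : ℝ → L2, MemLp β 2 (volume.restrict (Ioo t₁ T)) ∧ rescale T t₁ β = rescale T t₀ α := by
  have hL₀ : 0 < T - t₀ := sub_pos.2 h₀
  have hL₁ : 0 < T - t₁ := sub_pos.2 h₁
  set q := (T - t₀) / (T - t₁) with hq
  have hqL : q * (T - t₁) = T - t₀ := div_mul_cancel₀ _ hL₁.ne'
  refine ⟨fun t => q • α ((t₀ - q * t₁) + q * t), ?_, ?_⟩
  · refine (memLp_comp_affine (div_pos hL₀ hL₁) ?_).const_smul q
    rw [show t₀ - q * t₁ + q * t₁ = t₀ by ring,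
      show t₀ - q * t₁ + q * T = T by linear_combination hqL]
    exact hα
  · funext s
    simp only [rescale]
    rw [smul_smul, mul_comm (T - t₁) q, hqL,
      show t₀ - q * t₁ + q * (t₁ + (T - t₁) * s) = t₀ + (T - t₀) * s by
        linear_combination s * hqL]

/-! ### The value function -/

theorem cost_nonneg (hK : 0 ≤ K) (ht : t₀ ≤ T) : 0 ≤ cost K T φm t₀ α φ :=
  add_nonneg (intervalIntegral.integral_nonneg ht fun _ _ => by positivity) (by positivity)

theorem exists_isMildSolution (hδ : 0 < δ) (hF : IsRegularReaction (reaction δ V) M) (ht : t₀ ≤ T)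
    (hα : MemLp α 2 (volume.restrict (Ioo t₀ T))) (φ₀ : L2) :
    ∃ φ, IsMildSolution δ T V φ₀ t₀ α φ := by
  have hα' : IntegrableOn α (Ioc t₀ T) := by
    rw [integrableOn_Ioc_iff_integrableOn_Ioo]
    exact hα.integrable (by norm_num)
  obtain ⟨φ, h1, h2⟩ := exists_mildSolution hδ hF ht hα' φ₀
  exact ⟨φ, h1, h2⟩

theorem valueFunction_le_cost (hK : 0 ≤ K) (ht : t₀ ≤ T)
    (hα : MemLp α 2 (volume.restrict (Ioo t₀ T))) (h : IsMildSolution δ T V φ₀ t₀ α φ) :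
    valueFunction δ K T V φm φ₀ t₀ ≤ cost K T φm t₀ α φ :=
  csInf_le ⟨0, by rintro _ ⟨α, φ, -, -, rfl⟩; exact cost_nonneg hK ht⟩ ⟨α, φ, hα, h, rfl⟩

theorem exists_cost_lt (hδ : 0 < δ) (hF : IsRegularReaction (reaction δ V) M) (ht : t₀ ≤ T)
    {ε : ℝ} (hε : 0 < ε) :
    ∃ α φ : ℝ → L2, MemLp α 2 (volume.restrict (Ioo t₀ T)) ∧ IsMildSolution δ T V φ₀ t₀ α φ ∧
      cost K T φm t₀ α φ < valueFunction δ K T V φm φ₀ t₀ + ε := by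
  obtain ⟨φ, hφ⟩ := exists_isMildSolution hδ hF ht (α := 0) MemLp.zero φ₀
  obtain ⟨c, ⟨α, ψ, hα, hψ, rfl⟩, hc⟩ :=
    Real.lt_sInf_add_pos (s := {c : ℝ | ∃ α φ : ℝ → L2, MemLp α 2 (volume.restrict (Ioo t₀ T)) ∧
      IsMildSolution δ T V φ₀ t₀ α φ ∧ c = cost K T φm t₀ α φ})
      ⟨_, 0, φ, MemLp.zero, hφ, rfl⟩ hε
  exact ⟨α, ψ, hα, hψ, hc⟩

/-- The control `0` gives a bound of the value function, hence of the energy of nearly optimal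
controls. -/
theorem valueFunction_le (hδ : 0 < δ) (hK : 0 ≤ K) (hF : IsRegularReaction (reaction δ V) M)
    (h0 : 0 ≤ t₀) (ht : t₀ ≤ T) (hR : ‖φ₀‖ ≤ R) :
    valueFunction δ K T V φm φ₀ t₀ ≤ K * (R + M * T + ‖φm‖) ^ 2 := by
  obtain ⟨φ, hφ⟩ := exists_isMildSolution hδ hF ht (α := 0) MemLp.zero φ₀
  refine (valueFunction_le_cost hK ht MemLp.zero hφ).trans ?_
  have h1 : ‖φ T‖ ≤ R + M * T := by
    rw [hφ.2 T (right_mem_Icc.2 ht)]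
    refine (norm_add_le _ _).trans (add_le_add
      ((norm_heatSemigroup_le hδ (sub_nonneg.2 ht) _).trans hR) ?_)
    have h2 := intervalIntegral.norm_integral_le_of_norm_le_const (a := t₀) (b := T) (C := M)
      (f := fun s => heatSemigroup δ (T - s) (-(δ⁻¹ • superposition (deriv V) (φ s))
        + (0 : ℝ → L2) s)) fun s hs => by
      rw [uIoc_of_le ht] at hs
      rw [Pi.zero_apply, add_zero]
      exact (norm_heatSemigroup_le hδ (sub_nonneg.2 hs.2) _).trans (hF.bound (φ s))
    refine h2.trans (mul_le_mul_of_nonneg_left ?_ hF.nonneg)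
    rw [abs_of_nonneg (sub_nonneg.2 ht)]
    linarith
  have h3 : ‖φ T - φm‖ ≤ R + M * T + ‖φm‖ := (norm_sub_le _ _).trans (add_le_add h1 le_rfl)
  have h4 : cost K T φm t₀ 0 φ = K * ‖φ T - φm‖ ^ 2 := by simp [cost]
  rw [h4]
  gcongr

end Rescaling

/-! ### Semiconcavity -/

theorem IsScaledSolution.norm_apply_one_le {δ l T R A M L : ℝ} {F : L2 → L2} {φ₀ : L2}
    {a z : ℝ → L2} (hδ : 0 < δ) (hl : 0 < l) (hF : IsRegularReaction F M)
    (h : IsScaledSolution δ F l T R A L φ₀ a z) : ‖z 1‖ ≤ R + (T * M + (1 + A)) := by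
  have h1 : (1 : ℝ) ∈ Icc (0 : ℝ) 1 := right_mem_Icc.2 zero_le_one
  have hL := hl.le.trans h.le_scale
  have hi := intervalIntegrable_of_integrableOn h.integrableOn.norm h1
  rw [h.eq 1 h1]
  refine (norm_add_le _ _).trans (add_le_add ((norm_heatSemigroup_le hδ
    (mul_nonneg hL zero_le_one) _).trans h.norm_init_le) ?_)
  have h2 : ‖∫ s in (0 : ℝ)..1, heatSemigroup δ (L * (1 - s)) (forcing F L a z s)‖
      ≤ ∫ s in (0 : ℝ)..1, (T * M + ‖a s‖) :=
    intervalIntegral.norm_integral_le_of_norm_le zero_le_one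
      (Filter.Eventually.of_forall fun s hs => (norm_heatSemigroup_le hδ
        (mul_nonneg hL (sub_nonneg.2 hs.2)) _).trans (h.norm_forcing_le hl hF s))
      (intervalIntegrable_const.add hi)
  rw [intervalIntegral.integral_add intervalIntegrable_const hi,
    intervalIntegral.integral_const, smul_eq_mul, sub_zero, one_mul] at h2
  linarith [h.integral_norm_le h1]

theorem convex_combination_norm_sq {H : Type*} [NormedAddCommGroup H] [InnerProductSpace ℝ H]
    (r : ℝ) (p q : H) : r * ‖p‖ ^ 2 + (1 - r) * ‖q‖ ^ 2
      = ‖r • p + (1 - r) • q‖ ^ 2 + r * (1 - r) * ‖p - q‖ ^ 2 := by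
  rw [norm_add_sq_real, norm_sub_sq_real, norm_smul, norm_smul, mul_pow, mul_pow,
    Real.norm_eq_abs, Real.norm_eq_abs, sq_abs, sq_abs, inner_smul_left, inner_smul_right]
  simp only [conj_trivial]
  ring

theorem second_difference_inv_le {l L₁ L₂ r : ℝ} (hl : 0 < l) (h₁ : l ≤ L₁) (h₂ : l ≤ L₂)
    (hr : r ∈ Icc (0 : ℝ) 1) :
    r / L₁ + (1 - r) / L₂ - 1 / (r * L₁ + (1 - r) * L₂)
      ≤ r * (1 - r) * (L₁ - L₂) ^ 2 / l ^ 3 := by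
  have hr1 : 0 ≤ 1 - r := by linarith [hr.2]
  have hL : l ≤ r * L₁ + (1 - r) * L₂ := by
    linarith [mul_le_mul_of_nonneg_left h₁ hr.1, mul_le_mul_of_nonneg_left h₂ hr1]
  have p₁ : 0 < L₁ := hl.trans_le h₁
  have p₂ : 0 < L₂ := hl.trans_le h₂
  have p : 0 < r * L₁ + (1 - r) * L₂ := hl.trans_le hL
  have e : r / L₁ + (1 - r) / L₂ - 1 / (r * L₁ + (1 - r) * L₂)
      = r * (1 - r) * (L₁ - L₂) ^ 2 / (L₁ * L₂ * (r * L₁ + (1 - r) * L₂)) := by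
    field_simp
    ring
  rw [e]
  have hr' := mul_nonneg hr.1 hr1
  refine div_le_div_of_nonneg_left (by positivity) (by positivity) ?_
  calc l ^ 3 = l * l * l := by ring
    _ ≤ _ := by gcongr

/-- Semiconcavity on bounded subsets of `L²(0,1)`, away from the terminal time. -/
theorem exists_valueFunction_second_difference_le {δ K T M b R : ℝ} {V : ℝ → ℝ} {φm : L2}
    (hδ : 0 < δ) (hK : 0 ≤ K) (hF : IsRegularReaction (reaction δ V) M) (hb : b < T) (hT : 0 ≤ T)
    (hR : 0 ≤ R) :
    ∃ C, 0 ≤ C ∧ ∀ (φ₁ φ₂ : L2) (t₁ t₂ r : ℝ), ‖φ₁‖ ≤ R → ‖φ₂‖ ≤ R → t₁ ∈ Icc 0 b → t₂ ∈ Icc 0 b →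
      r ∈ Icc (0 : ℝ) 1 →
      r * valueFunction δ K T V φm φ₁ t₁ + (1 - r) * valueFunction δ K T V φm φ₂ t₂
        - valueFunction δ K T V φm (r • φ₁ + (1 - r) • φ₂) (r * t₁ + (1 - r) * t₂)
      ≤ C * (r * (1 - r)) * (‖φ₁ - φ₂‖ + |t₁ - t₂|) ^ 2 := by
  have hM := hF.nonneg
  set l := T - b with hldef
  have hl : 0 < l := sub_pos.2 hb
  -- a bound of the energy of controls that are optimal up to an error of at most `1`
  set A := 2 * T * (K * (R + M * T + ‖φm‖) ^ 2 + 1) with hAdef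
  have hA : 0 ≤ A := by positivity
  obtain ⟨C₁, hC₁, hlip⟩ := exists_norm_scaledSolution_sub_le hδ hl hT hR hA hF
  obtain ⟨C₃, hC₃, hsec⟩ := exists_norm_scaledSolution_second_difference_le hδ hl hT hR hA hF
  set P := R + (T * M + (1 + A)) + ‖φm‖ with hP
  have hP0 : 0 ≤ P := by positivity
  refine ⟨A / (2 * l ^ 3) + K * (C₁ ^ 2 + C₃ * (2 * P)), by positivity, ?_⟩
  intro φ₁ φ₂ t₁ t₂ r hφ₁ hφ₂ ht₁ ht₂ hr
  have hr1 : 0 ≤ 1 - r := by linarith [hr.2]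
  have hr' : 0 ≤ r * (1 - r) := mul_nonneg hr.1 hr1
  set D := ‖φ₁ - φ₂‖ + |t₁ - t₂| with hD
  have hD0 : 0 ≤ D := by positivity
  set t := r * t₁ + (1 - r) * t₂ with htdef
  have ht0 : 0 ≤ t := add_nonneg (mul_nonneg hr.1 ht₁.1) (mul_nonneg hr1 ht₂.1)
  have htb : t ≤ b := by
    linarith [mul_le_mul_of_nonneg_left ht₁.2 hr.1, mul_le_mul_of_nonneg_left ht₂.2 hr1]
  have htT : t < T := htb.trans_lt hb
  have h₁T : t₁ < T := ht₁.2.trans_lt hb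
  have h₂T : t₂ < T := ht₂.2.trans_lt hb
  have hφ : ‖r • φ₁ + (1 - r) • φ₂‖ ≤ R := by
    refine (norm_add_le _ _).trans ?_
    rw [norm_smul, norm_smul, Real.norm_of_nonneg hr.1, Real.norm_of_nonneg hr1]
    linarith [mul_le_mul_of_nonneg_left hφ₁ hr.1, mul_le_mul_of_nonneg_left hφ₂ hr1]
  -- compare with a control that is optimal up to `min ε 1`
  refine le_of_forall_pos_le_add fun ε hε => ?_
  obtain ⟨α, φ, hα, hmild, hcost⟩ := exists_cost_lt (K := K) (φm := φm)
    (φ₀ := r • φ₁ + (1 - r) • φ₂) hδ hF htT.le (lt_min hε one_pos)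
  obtain ⟨α₁, hα₁, ha₁⟩ := exists_rescale_eq htT h₁T hα
  obtain ⟨α₂, hα₂, ha₂⟩ := exists_rescale_eq htT h₂T hα
  obtain ⟨ψ₁, hψ₁⟩ := exists_isMildSolution hδ hF h₁T.le hα₁ φ₁
  obtain ⟨ψ₂, hψ₂⟩ := exists_isMildSolution hδ hF h₂T.le hα₂ φ₂
  have hv₁ := valueFunction_le_cost (φm := φm) hK h₁T.le hα₁ hψ₁
  have hv₂ := valueFunction_le_cost (φm := φm) hK h₂T.le hα₂ hψ₂
  have hv := valueFunction_le (φm := φm) hδ hK hF ht0 htT.le hφ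
  rw [cost_eq_rescale h₁T, ha₁] at hv₁
  rw [cost_eq_rescale h₂T, ha₂] at hv₂
  rw [cost_eq_rescale htT] at hcost
  set a := rescale T t α with ha
  set E := ∫ s in (0 : ℝ)..1, ‖a s‖ ^ 2 with hE
  have hE0 : 0 ≤ E := intervalIntegral.integral_nonneg zero_le_one fun _ _ => sq_nonneg _
  have hL : 0 < T - t := sub_pos.2 htT
  have hEA : E ≤ A := by
    have h1 : E / (2 * (T - t)) ≤ K * (R + M * T + ‖φm‖) ^ 2 + 1 := by
      have := min_le_right ε 1
      have : 0 ≤ K * ‖φ (t + (T - t) * 1) - φm‖ ^ 2 := by positivity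
      linarith
    rw [div_le_iff₀ (by positivity)] at h1
    have h2 : 0 ≤ K * (R + M * T + ‖φm‖) ^ 2 + 1 := by positivity
    have h3 := mul_le_mul_of_nonneg_left (by linarith : 2 * (T - t) ≤ 2 * T) h2
    rw [hAdef]
    linarith
  have s₁ := isScaledSolution_of_isMildSolution (l := l) (A := A) h₁T (by linarith [ht₁.2]) ht₁.1
    hφ₁ hα₁ (by rw [ha₁]; exact hEA) hψ₁
  have s₂ := isScaledSolution_of_isMildSolution (l := l) (A := A) h₂T (by linarith [ht₂.2]) ht₂.1
    hφ₂ hα₂ (by rw [ha₂]; exact hEA) hψ₂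
  have s := isScaledSolution_of_isMildSolution (l := l) (A := A) htT (by linarith) ht0
    hφ hα hEA hmild
  rw [ha₁] at s₁
  rw [ha₂] at s₂
  have hLr : T - t = r * (T - t₁) + (1 - r) * (T - t₂) := by rw [htdef]; ring
  rw [← ha] at s
  have hab : |(T - t₁) - (T - t₂)| = |t₁ - t₂| := by
    rw [abs_sub_comm]; congr 1; ring
  have one_mem : (1 : ℝ) ∈ Icc (0 : ℝ) 1 := right_mem_Icc.2 zero_le_one
  have d := hlip s₁ s₂ 1 one_mem
  have d2 := hsec hr s₁ s₂ (by rw [← hLr]; exact s) 1 one_mem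
  have n := s.norm_apply_one_le hδ hl hF
  have n₁ := s₁.norm_apply_one_le hδ hl hF
  have n₂ := s₂.norm_apply_one_le hδ hl hF
  have hi := second_difference_inv_le hl s₁.le_scale s₂.le_scale hr
  rw [← hLr, show (T - t₁) - (T - t₂) = -(t₁ - t₂) by ring, neg_sq] at hi
  rw [hab, ← hD] at d d2
  clear s s₁ s₂ hψ₁ hψ₂ hmild hα hα₁ hα₂ ha₁ ha₂
  generalize φ (t + (T - t) * 1) = z at *
  generalize ψ₁ (t₁ + (T - t₁) * 1) = z₁ at *
  generalize ψ₂ (t₂ + (T - t₂) * 1) = z₂ at *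
  -- the terminal cost
  have hterm : r * ‖z₁ - φm‖ ^ 2 + (1 - r) * ‖z₂ - φm‖ ^ 2 - ‖z - φm‖ ^ 2
      ≤ r * (1 - r) * D ^ 2 * (C₁ ^ 2 + C₃ * (2 * P)) := by
    rw [convex_combination_norm_sq, sub_sub_sub_cancel_right,
      show r • (z₁ - φm) + (1 - r) • (z₂ - φm) = (r • z₁ + (1 - r) • z₂) - φm by module]
    have q₁ : ‖r • z₁ + (1 - r) • z₂ - φm‖ ≤ P := by
      refine (norm_sub_le _ _).trans (add_le_add ((norm_add_le _ _).trans ?_) le_rfl)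
      rw [norm_smul, norm_smul, Real.norm_of_nonneg hr.1, Real.norm_of_nonneg hr1]
      linarith [mul_le_mul_of_nonneg_left n₁ hr.1, mul_le_mul_of_nonneg_left n₂ hr1]
    have q₂ : ‖z - φm‖ ≤ P := (norm_sub_le _ _).trans (add_le_add n le_rfl)
    have q₃ : ‖r • z₁ + (1 - r) • z₂ - φm‖ - ‖z - φm‖ ≤ C₃ * (r * (1 - r)) * D ^ 2 := by
      refine (norm_sub_norm_le _ _).trans ?_
      rw [sub_sub_sub_cancel_right]
      exact d2
    have q₄ : ‖r • z₁ + (1 - r) • z₂ - φm‖ ^ 2 - ‖z - φm‖ ^ 2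
        ≤ C₃ * (r * (1 - r)) * D ^ 2 * (2 * P) := by
      calc _ = (‖r • z₁ + (1 - r) • z₂ - φm‖ - ‖z - φm‖)
            * (‖r • z₁ + (1 - r) • z₂ - φm‖ + ‖z - φm‖) := by ring
        _ ≤ C₃ * (r * (1 - r)) * D ^ 2 * (‖r • z₁ + (1 - r) • z₂ - φm‖ + ‖z - φm‖) :=
            mul_le_mul_of_nonneg_right q₃ (by positivity)
        _ ≤ _ := mul_le_mul_of_nonneg_left (by linarith) (by positivity)
    have q₅ : ‖z₁ - z₂‖ ^ 2 ≤ (C₁ * D) ^ 2 := pow_le_pow_left₀ (norm_nonneg _) d 2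
    have q₆ := mul_le_mul_of_nonneg_left q₅ hr'
    linarith
  -- the energy
  have hctrl : r * (E / (2 * (T - t₁))) + (1 - r) * (E / (2 * (T - t₂))) - E / (2 * (T - t))
      ≤ r * (1 - r) * D ^ 2 * (A / (2 * l ^ 3)) := by
    have hts : (t₁ - t₂) ^ 2 ≤ D ^ 2 := by
      rw [← sq_abs]
      exact pow_le_pow_left₀ (abs_nonneg _) (le_add_of_nonneg_left (norm_nonneg _)) 2
    calc r * (E / (2 * (T - t₁))) + (1 - r) * (E / (2 * (T - t₂))) - E / (2 * (T - t))
        = E / 2 * (r / (T - t₁) + (1 - r) / (T - t₂) - 1 / (T - t)) := by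
          simp only [div_eq_mul_inv, mul_inv]; ring
      _ ≤ E / 2 * (r * (1 - r) * (t₁ - t₂) ^ 2 / l ^ 3) :=
          mul_le_mul_of_nonneg_left hi (by positivity)
      _ ≤ A / 2 * (r * (1 - r) * D ^ 2 / l ^ 3) := by gcongr
      _ = _ := by field_simp
  have hε' := min_le_left ε 1
  have m₁ := mul_le_mul_of_nonneg_left hv₁ hr.1
  have m₂ := mul_le_mul_of_nonneg_left hv₂ hr1
  have m₃ := mul_le_mul_of_nonneg_left hterm hK
  linarith

end SemiconcaveValue

open SemiconcaveValue in
theorem mainTheorem8 (δ K T : ℝ) (hδ : 0 < δ) (hK : 0 < K) (hT : 0 < T)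
    (V : ℝ → ℝ) (hV : ContDiff ℝ 3 V)
    (hVb : ∀ k ∈ ({1, 2, 3} : Set ℕ), ∃ M : ℝ, ∀ y : ℝ, |iteratedDeriv k V y| ≤ M)
    (φm : L2)
    (B a b : ℝ) (hab : Set.Icc a b ⊆ Set.Ico 0 T) :
    ∃ C : ℝ, ∀ φ₁ φ₂ : H10, ‖φ₁‖ + ‖φ₂‖ ≤ B →
      ∀ t₁ ∈ Set.Icc a b, ∀ t₂ ∈ Set.Icc a b,
        (∀ r ∈ Set.Icc (0 : ℝ) 1,
          r * valueFunction δ K T V φm (toL2 φ₁) t₁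
              + (1 - r) * valueFunction δ K T V φm (toL2 φ₂) t₂
              - valueFunction δ K T V φm (toL2 (r • φ₁ + (1 - r) • φ₂))
                  (r * t₁ + (1 - r) * t₂)
            ≤ C * (r * (1 - r)) * (‖φ₁ - φ₂‖ ^ 2 + |t₁ - t₂| ^ 2)) ∧
        valueFunction δ K T V φm (toL2 φ₁) t₁ + valueFunction δ K T V φm (toL2 φ₂) t₂
            - 2 * valueFunction δ K T V φm (toL2 ((2⁻¹ : ℝ) • (φ₁ + φ₂))) ((t₁ + t₂) / 2)
          ≤ C * (‖φ₁ - φ₂‖ ^ 2 + |t₁ - t₂| ^ 2) := by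
  rcases lt_or_ge b a with hba | hba
  · refine ⟨0, fun _ _ _ t₁ ht₁ => ?_⟩
    rw [Icc_eq_empty (not_le.2 hba)] at ht₁
    exact absurd ht₁ (notMem_empty _)
  have hb : b < T := (hab (right_mem_Icc.2 hba)).2
  have ha : 0 ≤ a := (hab (left_mem_Icc.2 hba)).1
  obtain ⟨M, hF⟩ := exists_isRegularReaction hδ hV hVb
  obtain ⟨C, hC, h⟩ := exists_valueFunction_second_difference_le (φm := φm) hδ hK.le hF hb hT.le
    (abs_nonneg B)
  have hn : ∀ φ : H10, ‖toL2 φ‖ ≤ ‖φ‖ := fun φ => WithLp.norm_fst_le _ _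
  refine ⟨2 * C, fun φ₁ φ₂ hB t₁ ht₁ t₂ ht₂ => ?_⟩
  have key : ∀ r ∈ Set.Icc (0 : ℝ) 1,
      r * valueFunction δ K T V φm (toL2 φ₁) t₁
          + (1 - r) * valueFunction δ K T V φm (toL2 φ₂) t₂
          - valueFunction δ K T V φm (toL2 (r • φ₁ + (1 - r) • φ₂)) (r * t₁ + (1 - r) * t₂)
        ≤ 2 * C * (r * (1 - r)) * (‖φ₁ - φ₂‖ ^ 2 + |t₁ - t₂| ^ 2) := by
    intro r hr
    have hr' : 0 ≤ r * (1 - r) := mul_nonneg hr.1 (by linarith [hr.2])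
    have h₁ : ‖toL2 φ₁‖ ≤ |B| :=
      (hn φ₁).trans ((le_add_of_nonneg_right (norm_nonneg φ₂)).trans (hB.trans (le_abs_self B)))
    have h₂ : ‖toL2 φ₂‖ ≤ |B| :=
      (hn φ₂).trans ((le_add_of_nonneg_left (norm_nonneg φ₁)).trans (hB.trans (le_abs_self B)))
    refine (h (toL2 φ₁) (toL2 φ₂) t₁ t₂ r h₁ h₂ ⟨ha.trans ht₁.1, ht₁.2⟩ ⟨ha.trans ht₂.1, ht₂.2⟩
      hr).trans ?_
    have hd : ‖toL2 φ₁ - toL2 φ₂‖ ≤ ‖φ₁ - φ₂‖ := hn (φ₁ - φ₂)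
    have hsq : (‖toL2 φ₁ - toL2 φ₂‖ + |t₁ - t₂|) ^ 2
        ≤ 2 * (‖φ₁ - φ₂‖ ^ 2 + |t₁ - t₂| ^ 2) := by
      have h3 : (‖toL2 φ₁ - toL2 φ₂‖ + |t₁ - t₂|) ^ 2 ≤ (‖φ₁ - φ₂‖ + |t₁ - t₂|) ^ 2 := by
        gcongr
      linarith [sq_nonneg (‖φ₁ - φ₂‖ - |t₁ - t₂|)]
    linarith [mul_le_mul_of_nonneg_left hsq (mul_nonneg hC hr')]
  refine ⟨key, ?_⟩
  have h2 := key 2⁻¹ ⟨by norm_num, by norm_num⟩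
  have e : (2⁻¹ : ℝ) • φ₁ + (1 - 2⁻¹ : ℝ) • φ₂ = (2⁻¹ : ℝ) • (φ₁ + φ₂) := by
    rw [smul_add]; norm_num
  rw [e, show (2⁻¹ : ℝ) * t₁ + (1 - 2⁻¹) * t₂ = (t₁ + t₂) / 2 by ring] at h2
  have hQ : 0 ≤ C * (‖φ₁ - φ₂‖ ^ 2 + |t₁ - t₂| ^ 2) := by positivity
  linarith
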